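/- Let $G$ be a finite two-player game with nonempty finite sets of pure strategies $S_1,S_2$ of sizes $m_1,m_2$ and real payoffs. For a mixed strategy $\sigma\in\Delta(S_{-i})$ of the opponent let $BR_i(\sigma)\subset S_i$ be the set of pure best replies of player $i$. Fix a sample size $k\ge 1$ and a recency parameter $\beta\in(0,1)$, and let $\varepsilon\in[0,1]$ be an error probability. The recency weighted sampler (RWS) is the Markov chain on $\square(S)=\Delta(S_1)\times\Delta(S_2)$ which moves from $(p_1,p_2)$ to $$\bigl(\beta p_1+(1-\beta)\mathbf 1_{s_1},\ \beta p_2+(1-\beta)\mathbf 1_{s_2}\bigr),$$ where $\mathbf 1_{s}$ is the unit vector of the pure strategy $s$, and $s_1,s_2$ are chosen independently as follows: player $i$ draws $k$ independent pure strategies of the opponent from $p_{-i}$ and forms their empirical distribution $D_{-i}$; with probability $1-\varepsilon$ she takes $s_i$ uniformly at random from $BR_i(D_{-i})$, and with probability $\varepsilon$ uniformly at random from $S_i$. A block $C=C_1\times C_2$ with nonempty $C_i\subset S_i$ is called a CURB block (relative to the sample size $k$) if, for $i=1,2$, $BR_i(\sigma)\subset C_i$ for every $\sigma\in\Delta(S_{-i})$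 with support in $C_{-i}$ all of whose weights are integer multiples of $1/k$; it is minimal if it contains no strictly smaller CURB block. For $\delta>0$ put $$B_\delta(C_1\times C_2)=\Bigl\{(p_1,p_2)\in\square(S):\ \sum_{s\in C_i}p_{i,s}\ge 1-\delta,\ i=1,2\Bigr\},$$ and, for the union $\mathscr C$ of all minimal CURB blocks, let $B_\delta(\mathscr C)=\bigcup_C B_\delta(C)$, the union over all minimal CURB blocks $C$. **Theorem.** Assume $\beta\in\bigl(1-\tfrac1{\max\{m_1,m_2\}},\,1\bigr)$. For every $\varepsilon\in(0,1]$ the RWS has exactly one invariant Borel probability measure $\mu^*_\varepsilon$ on $\square(S)$, and for every $\delta>0$ $$\lim_{\varepsilon\downarrow 0}\mu^*_\varepsilon\bigl(B_\delta(\mathscr C)\bigr)=1 .$$ -/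

import Mathlib

open MeasureTheory ProbabilityTheory

namespace RWS

/-! ### Best replies, for one player with action set `A` facing an opponent with action set `B`.
`π a b` is the player's payoff when she plays `a` and the opponent plays `b`. -/

/-- Expected payoff of the pure action `a` against the mixed strategy `σ`. -/
def expectedPayoff {A B : Type*} [Fintype B] (π : A → B → ℝ) (a : A) (σ : B → ℝ) : ℝ :=
  ∑ b, σ b * π a b

/-- The set `BR(σ)` of pure best replies to the mixed strategy `σ`. -/
noncomputable def bestReplies {A B : Type*} [Fintype A] [Fintype B] (π : A → B → ℝ)
    (σ : B → ℝ) : Finset A :=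
  Finset.univ.filter fun a => ∀ a', expectedPayoff π a' σ ≤ expectedPayoff π a σ

/-- The unit vector of the pure strategy `s`. -/
def unitVec {A : Type*} [DecidableEq A] (s : A) : A → ℝ := fun a => if a = s then 1 else 0

/-- The empirical distribution `D` of a sample `ω` of `k` opponent actions. -/
noncomputable def empirical {B : Type*} [DecidableEq B] {k : ℕ} (ω : Fin k → B) : B → ℝ :=
  fun b => (1 / (k : ℝ)) * ∑ j, unitVec (ω j) b

/-- The probability that the player, after `k` independent draws of opponent actions from `p`,
selects `a` when choosing uniformly among the best replies to the empirical distribution. -/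
noncomputable def bestReplyProb {A B : Type*} [Fintype A] [DecidableEq A] [Fintype B]
    [DecidableEq B] (π : A → B → ℝ) (k : ℕ) (p : stdSimplex ℝ B) (a : A) : ℝ :=
  ∑ ω : Fin k → B, (∏ j, p.1 (ω j)) *
    (if a ∈ bestReplies π (empirical ω)
      then 1 / ((bestReplies π (empirical ω)).card : ℝ) else 0)

/-- The probability that the player finally plays `a`, when with probability `ε` she errs and
plays a uniformly random action instead. -/
noncomputable def playProb {A B : Type*} [Fintype A] [DecidableEq A] [Fintype B]
    [DecidableEq B] (π : A → B → ℝ) (k : ℕ) (ε : ℝ) (p : stdSimplex ℝ B) (a : A) : ℝ :=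
  (1 - ε) * bestReplyProb π k p a + ε / (Fintype.card A : ℝ)

/-! ### The Markov chain -/

/-- The state space: pairs of mixed strategies. -/
abbrev State (S₁ S₂ : Type*) [Fintype S₁] [Fintype S₂] : Type _ :=
  stdSimplex ℝ S₁ × stdSimplex ℝ S₂

/-- The updated historical distribution `β p + (1 - β) 1_s` after the action `s` is played. -/
noncomputable def update {A : Type*} [Fintype A] [DecidableEq A] (β : unitInterval)
    (p : stdSimplex ℝ A) (s : A) : stdSimplex ℝ A :=
  ⟨fun a => (β : ℝ) * p.1 a + (1 - (β : ℝ)) * unitVec s a, by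
    refine ⟨fun a => ?_, ?_⟩
    · have h1 := p.2.1 a
      have h2 : (0 : ℝ) ≤ unitVec s a := by unfold unitVec; split_ifs <;> norm_num
      exact add_nonneg (mul_nonneg β.2.1 h1) (mul_nonneg (sub_nonneg.2 β.2.2) h2)
    · rw [Finset.sum_add_distrib, ← Finset.mul_sum, ← Finset.mul_sum, p.2.2]
      simp [unitVec]⟩

section Kernel

variable {S₁ S₂ : Type*} [Fintype S₁] [DecidableEq S₁] [Fintype S₂] [DecidableEq S₂]

/-- The law of the next state given the state `p = (p₁, p₂)`: the players choose independently,
player 1 reacting to `p₂` and player 2 to `p₁`. Both payoff functions take the player's own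
action first. -/
noncomputable def transition (u₁ : S₁ → S₂ → ℝ) (u₂ : S₂ → S₁ → ℝ) (k : ℕ) (β : unitInterval)
    (ε : ℝ) (p : State S₁ S₂) : Measure (State S₁ S₂) :=
  ∑ s₁ : S₁, ∑ s₂ : S₂,
    ENNReal.ofReal (playProb u₁ k ε p.2 s₁ * playProb u₂ k ε p.1 s₂) •
      Measure.dirac (update β p.1 s₁, update β p.2 s₂)

theorem measurable_playProb {A B : Type*} [Fintype A] [DecidableEq A] [Fintype B]
    [DecidableEq B] (π : A → B → ℝ) (k : ℕ) (ε : ℝ) (a : A) :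
    Measurable fun p : stdSimplex ℝ B => playProb π k ε p a := by
  unfold playProb bestReplyProb
  refine Measurable.add_const (Measurable.const_mul ?_ _) _
  refine Finset.measurable_sum _ fun ω _ => Measurable.mul_const ?_ _
  exact Finset.measurable_prod _ fun j _ => (measurable_pi_apply (ω j)).comp measurable_subtype_coe

theorem measurable_update {A : Type*} [Fintype A] [DecidableEq A] (β : unitInterval) (s : A) :
    Measurable fun p : stdSimplex ℝ A => update β p s := by
  refine Measurable.subtype_mk (measurable_pi_lambda _ fun a => ?_)
  exact Measurable.add_const
    (((measurable_pi_apply a).comp measurable_subtype_coe).const_mul _) _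

theorem measurable_transition (u₁ : S₁ → S₂ → ℝ) (u₂ : S₂ → S₁ → ℝ) (k : ℕ)
    (β : unitInterval) (ε : ℝ) : Measurable (transition u₁ u₂ k β ε) := by
  refine Measure.measurable_of_measurable_coe _ fun B hB => ?_
  simp only [transition, Measure.finsetSum_apply, Measure.smul_apply, smul_eq_mul]
  refine Finset.measurable_sum _ fun s₁ _ => Finset.measurable_sum _ fun s₂ _ => ?_
  refine Measurable.mul (ENNReal.measurable_ofReal.comp
    (((measurable_playProb u₁ k ε s₁).comp measurable_snd).mul
      ((measurable_playProb u₂ k ε s₂).comp measurable_fst))) ?_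
  exact (Measure.measurable_coe hB).comp (Measure.measurable_dirac.comp
    (((measurable_update β s₁).comp measurable_fst).prodMk
      ((measurable_update β s₂).comp measurable_snd)))

/-- The transition kernel `P` of the recency weighted sampler. -/
noncomputable def kernel (u₁ : S₁ → S₂ → ℝ) (u₂ : S₂ → S₁ → ℝ) (k : ℕ) (β : unitInterval)
    (ε : ℝ) : Kernel (State S₁ S₂) (State S₁ S₂) :=
  ⟨transition u₁ u₂ k β ε, measurable_transition u₁ u₂ k β ε⟩

/-! ### CURB blocks -/

/-- The mixed strategies with support in `C` that lie on the `k`-lattice, i.e. whose weights are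
multiples of `1 / k`. -/
def lattice {B : Type*} [Fintype B] (k : ℕ) (C : Finset B) : Set (B → ℝ) :=
  {σ | (∃ n : B → ℕ, ∑ b, n b = k ∧ ∀ b, σ b = (n b : ℝ) / (k : ℝ)) ∧ ∀ b, b ∉ C → σ b = 0}

/-- `C = C₁ × C₂` is a `k`-CURB block: it is nonempty and contains all best replies to mixed
strategies on the `k`-lattice with support in the block. -/
def IsCurb (u₁ : S₁ → S₂ → ℝ) (u₂ : S₂ → S₁ → ℝ) (k : ℕ) (C : Finset S₁ × Finset S₂) : Prop :=
  C.1.Nonempty ∧ C.2.Nonempty ∧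
    (∀ σ ∈ lattice k C.2, bestReplies u₁ σ ⊆ C.1) ∧
    (∀ σ ∈ lattice k C.1, bestReplies u₂ σ ⊆ C.2)

/-- A `k`-CURB block that contains no strictly smaller one (blocks are ordered by inclusion in
each component). -/
def IsMinCurb (u₁ : S₁ → S₂ → ℝ) (u₂ : S₂ → S₁ → ℝ) (k : ℕ)
    (C : Finset S₁ × Finset S₂) : Prop :=
  Minimal (IsCurb u₁ u₂ k) C

/-- The neighbourhood `B_δ(C₁ × C₂)` of a block. -/
def blockNhd (δ : ℝ) (C : Finset S₁ × Finset S₂) : Set (State S₁ S₂) :=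
  {p | 1 - δ ≤ ∑ s ∈ C.1, p.1.1 s ∧ 1 - δ ≤ ∑ s ∈ C.2, p.2.1 s}

/-- The neighbourhood of the union of the minimal CURB blocks: the states that are in the
neighbourhood of one of them. -/
def minCurbNhd (u₁ : S₁ → S₂ → ℝ) (u₂ : S₂ → S₁ → ℝ) (k : ℕ) (δ : ℝ) : Set (State S₁ S₂) :=
  ⋃ C ∈ {C | IsMinCurb u₁ u₂ k C}, blockNhd δ C

end Kernel

end RWS

/-!
The sampler is an iterated function system with place-dependent probabilities: it applies the
contraction `jointUpdate β s` with the probability `jointProb s p`. When errors occur these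
probabilities are bounded below, and two copies of the chain can be coupled so that their distance,
truncated at a small scale, contracts on average; this gives uniqueness of the invariant measure.

For the limit, let `V` be the capped weight outside the nearest minimal CURB block. Without errors,
`V` contracts near a minimal CURB block. From an arbitrary state, best replies to samples from the
frequently played actions enlarge this set of actions until it contains a minimal CURB block, which
is then approached with positive probability. Hence `P₀ ^ N V ≤ θ V` for some `N` and `θ < 1`.
Errors change a transition probability by `O(ε)`, so `∫ V ∂μ_ε = O(ε)`.
-/

namespace RWS

open Filter Topology
open scoped NNReal

section MarkovOp

variable {ι X : Type*} [Fintype ι]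

/-- The Markov operator of the chain that moves from `x` to `T i x` with probability `q i x`. -/
def markovOp (q : ι → X → ℝ) (T : ι → X → X) (f : X → ℝ) : X → ℝ :=
  fun x => ∑ i, q i x * f (T i x)

/-- The functions `q i` are state-dependent probability weights on `ι`. -/
structure IsWeight (q : ι → X → ℝ) : Prop where
  nonneg : ∀ i x, 0 ≤ q i x
  sum_eq_one : ∀ x, ∑ i, q i x = 1

/-- From every starting point in `A` the expectation of `f` after some fixed number of steps is
bounded away from `1`. For functions `f ≤ 1` this is a way to say that the set `{f < 1}` is reached
from `A` with uniformly positive probability. -/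
def DropsOn (q : ι → X → ℝ) (T : ι → X → X) (f : X → ℝ) (A : Set X) : Prop :=
  ∃ N : ℕ, ∃ η > 0, ∀ x ∈ A, (markovOp q T)^[N] f x ≤ 1 - η

/-- The iterates of the Markov operator on `f` become uniformly close to constants. -/
def AsymptoticallyConstant (q : ι → X → ℝ) (T : ι → X → X) (f : X → ℝ) : Prop :=
  ∀ e > 0, ∀ᶠ n in atTop, ∀ x y, (markovOp q T)^[n] f x - (markovOp q T)^[n] f y ≤ e

variable {q q' : ι → X → ℝ} {T : ι → X → X} {f : X → ℝ}

theorem continuous_iterate_markovOp [TopologicalSpace X] (hq : ∀ i, Continuous (q i))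
    (hT : ∀ i, Continuous (T i)) (hf : Continuous f) (n : ℕ) :
    Continuous ((markovOp q T)^[n] f) := by
  induction n with
  | zero => exact hf
  | succ n ih =>
    rw [Function.iterate_succ_apply']
    exact continuous_finsetSum _ fun i _ => (hq i).mul (ih.comp (hT i))

theorem markovOp_le_add_of_sum_abs_sub_le {r : ℝ} {x : X} (hr : ∑ i, |q i x - q' i x| ≤ r)
    (hf : ∀ y, |f y| ≤ 1) : markovOp q T f x ≤ markovOp q' T f x + r := by
  rw [← sub_le_iff_le_add']
  calc markovOp q T f x - markovOp q' T f x
      = ∑ i, (q i x - q' i x) * f (T i x) := by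
        simp only [markovOp, ← Finset.sum_sub_distrib, sub_mul]
    _ ≤ ∑ i, |q i x - q' i x| := Finset.sum_le_sum fun i _ =>
        (le_abs_self _).trans <| by
          rw [abs_mul]
          exact mul_le_of_le_one_right (abs_nonneg _) (hf _)
    _ ≤ r := hr

theorem sum_mul_sub_sum_mul_le {a a' u v : ι → ℝ} {c o : ℝ} (ha : ∀ i, 0 ≤ a i)
    (ha' : ∀ i, 0 ≤ a' i) (sum_a : ∑ i, a i = c) (sum_a' : ∑ i, a' i = c)
    (huv : ∀ i j, u i - v j ≤ o) : ∑ i, a i * u i - ∑ i, a' i * v i ≤ c * o := by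
  rcases isEmpty_or_nonempty ι with hι | hι
  · simp [← sum_a]
  obtain ⟨j, -, hj⟩ := Finset.exists_min_image Finset.univ v Finset.univ_nonempty
  have sum_a_mul_le : ∑ i, a i * u i ≤ c * (v j + o) := by
    rw [← sum_a, Finset.sum_mul]
    exact Finset.sum_le_sum fun i _ =>
      mul_le_mul_of_nonneg_left (sub_le_iff_le_add'.1 (huv i j)) (ha i)
  have le_sum_a'_mul : c * v j ≤ ∑ i, a' i * v i := by
    rw [← sum_a', Finset.sum_mul]
    exact Finset.sum_le_sum fun i hi => mul_le_mul_of_nonneg_left (hj i hi) (ha' i)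
  linarith

theorem DropsOn.of_le {A : Set X} {η : ℝ} (hη : 0 < η) (hf : ∀ x ∈ A, f x ≤ 1 - η) :
    DropsOn q T f A :=
  ⟨0, η, hη, hf⟩

theorem DropsOn.mono {A B : Set X} (hB : DropsOn q T f B) (hAB : A ⊆ B) : DropsOn q T f A :=
  let ⟨N, η, hη, h⟩ := hB
  ⟨N, η, hη, fun x hx => h x (hAB hx)⟩

namespace IsWeight

theorem monotone_markovOp (hq : IsWeight q) : Monotone (markovOp q T) := fun _ _ hfg x =>
  Finset.sum_le_sum fun i _ => mul_le_mul_of_nonneg_left (hfg _) (hq.nonneg i x)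

theorem markovOp_const (hq : IsWeight q) (c : ℝ) :
    markovOp q T (fun _ => c) = fun _ => c := by
  funext x
  simp only [markovOp, ← Finset.sum_mul, hq.sum_eq_one, one_mul]

theorem markovOp_add_const (hq : IsWeight q) (f : X → ℝ) (c : ℝ) (x : X) :
    markovOp q T (fun y => f y + c) x = markovOp q T f x + c := by
  simp only [markovOp, mul_add, Finset.sum_add_distrib, ← Finset.sum_mul, hq.sum_eq_one, one_mul]

theorem iterate_markovOp_le (hq : IsWeight q) {c : ℝ} (hf : ∀ x, f x ≤ c) (n : ℕ) (x : X) :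
    (markovOp q T)^[n] f x ≤ c := by
  have hle := hq.monotone_markovOp (T := T).iterate n (show f ≤ fun _ => c from hf) x
  rwa [Function.iterate_fixed (hq.markovOp_const c)] at hle

theorem le_iterate_markovOp (hq : IsWeight q) {c : ℝ} (hf : ∀ x, c ≤ f x) (n : ℕ) (x : X) :
    c ≤ (markovOp q T)^[n] f x := by
  have hle := hq.monotone_markovOp (T := T).iterate n (show (fun _ => c) ≤ f from hf) x
  rwa [Function.iterate_fixed (hq.markovOp_const c)] at hle

theorem abs_iterate_markovOp_le (hq : IsWeight q) {c : ℝ} (hf : ∀ x, |f x| ≤ c) (n : ℕ) (x : X) :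
    |(markovOp q T)^[n] f x| ≤ c :=
  abs_le.2 ⟨hq.le_iterate_markovOp (fun y => (abs_le.1 (hf y)).1) n x,
    hq.iterate_markovOp_le (fun y => (abs_le.1 (hf y)).2) n x⟩

theorem iterate_markovOp_sub_le (hq : IsWeight q) {o : ℝ} (ho : ∀ x y, f x - f y ≤ o) (n : ℕ)
    (x y : X) : (markovOp q T)^[n] f x - (markovOp q T)^[n] f y ≤ o := by
  have le_add : ∀ z, (markovOp q T)^[n] f x ≤ f z + o := fun z =>
    hq.iterate_markovOp_le (fun w => sub_le_iff_le_add'.1 (ho w z)) n x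
  exact sub_le_comm.1 <| hq.le_iterate_markovOp (fun z => sub_le_iff_le_add.2 (le_add z)) n y

-- Couple the two chains so that each map `i` is used by both with probability at least `η`.
theorem markovOp_sub_le_coupling (hq : IsWeight q) {η r o : ℝ} (hη : 0 ≤ η)
    (hηq : ∀ i x, η ≤ q i x) (ho : ∀ x y, f x - f y ≤ o) {x y : X}
    (hr : ∀ i, f (T i x) - f (T i y) ≤ r) :
    markovOp q T f x - markovOp q T f y ≤
      Fintype.card ι * η * r + (1 - Fintype.card ι * η) * o := by
  have sum_residual : ∀ z, ∑ i, (q i z - η) = 1 - Fintype.card ι * η := fun z => by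
    rw [Finset.sum_sub_distrib, hq.sum_eq_one, Finset.sum_const, Finset.card_univ, nsmul_eq_mul]
  have residual_le := sum_mul_sub_sum_mul_le (fun i => sub_nonneg.2 (hηq i x))
    (fun i => sub_nonneg.2 (hηq i y)) (sum_residual x) (sum_residual y)
    fun i j => ho (T i x) (T j y)
  have common_le : ∑ i, η * (f (T i x) - f (T i y)) ≤ Fintype.card ι * η * r := by
    refine (Finset.sum_le_sum fun i _ => mul_le_mul_of_nonneg_left (hr i) hη).trans_eq ?_
    rw [Finset.sum_const, Finset.card_univ, nsmul_eq_mul, mul_assoc]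
  have split : markovOp q T f x - markovOp q T f y = ∑ i, η * (f (T i x) - f (T i y)) +
      (∑ i, (q i x - η) * f (T i x) - ∑ i, (q i y - η) * f (T i y)) := by
    simp only [markovOp, ← Finset.sum_sub_distrib, ← Finset.sum_add_distrib]
    exact Finset.sum_congr rfl fun i _ => by ring
  linarith

theorem iterate_markovOp_le_add (hq : IsWeight q) (hq' : IsWeight q') {r : ℝ}
    (hr : ∀ x, ∑ i, |q i x - q' i x| ≤ r) (hf : ∀ x, |f x| ≤ 1) (n : ℕ) (x : X) :
    (markovOp q T)^[n] f x ≤ (markovOp q' T)^[n] f x + n * r := by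
  induction n generalizing x with
  | zero => simp
  | succ n ih =>
    rw [Function.iterate_succ_apply', Function.iterate_succ_apply']
    calc markovOp q T ((markovOp q T)^[n] f) x
        ≤ markovOp q' T ((markovOp q T)^[n] f) x + r :=
          markovOp_le_add_of_sum_abs_sub_le (hr x) (hq.abs_iterate_markovOp_le hf n)
      _ ≤ markovOp q' T (fun y => (markovOp q' T)^[n] f y + n * r) x + r := by
          gcongr
          exact hq'.monotone_markovOp ih x
      _ = markovOp q' T ((markovOp q' T)^[n] f) x + (n + 1 : ℕ) * r := by
          rw [hq'.markovOp_add_const]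
          push_cast
          ring

theorem markovOp_le_one_sub_mul_sum (hq : IsWeight q) (hf : ∀ y, f y ≤ 1) {Q : Finset ι} {x : X}
    {a : ℝ} (hQ : ∀ i ∈ Q, f (T i x) ≤ a) :
    markovOp q T f x ≤ 1 - (1 - a) * ∑ i ∈ Q, q i x := by
  rw [le_sub_comm]
  calc (1 - a) * ∑ i ∈ Q, q i x
      = ∑ i ∈ Q, q i x * (1 - a) := by rw [mul_comm, Finset.sum_mul]
    _ ≤ ∑ i ∈ Q, q i x * (1 - f (T i x)) := Finset.sum_le_sum fun i hi =>
        mul_le_mul_of_nonneg_left (sub_le_sub_left (hQ i hi) 1) (hq.nonneg i x)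
    _ ≤ ∑ i, q i x * (1 - f (T i x)) :=
        Finset.sum_le_sum_of_subset_of_nonneg (Finset.subset_univ Q) fun i _ _ =>
          mul_nonneg (hq.nonneg i x) (sub_nonneg.2 (hf _))
    _ = 1 - markovOp q T f x := by
        simp only [markovOp, mul_sub, mul_one, Finset.sum_sub_distrib, hq.sum_eq_one]

theorem dropsOn_of_step (hq : IsWeight q) (hf : ∀ x, f x ≤ 1) {A B : Set X}
    (hB : DropsOn q T f B) {c : ℝ} (hc : 0 < c) (hAB : ∀ x ∈ A, ∃ i, c ≤ q i x ∧ T i x ∈ B) :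
    DropsOn q T f A := by
  obtain ⟨N, η, hη, hN⟩ := hB
  refine ⟨N + 1, η * c, mul_pos hη hc, fun x hx => ?_⟩
  obtain ⟨i, hci, hiB⟩ := hAB x hx
  have hstep := hq.markovOp_le_one_sub_mul_sum (Q := {i}) (x := x)
    (hq.iterate_markovOp_le (T := T) hf N) (a := 1 - η) (by simpa using hN _ hiB)
  rw [Finset.sum_singleton, sub_sub_cancel] at hstep
  rw [Function.iterate_succ_apply']
  exact hstep.trans (sub_le_sub_left (mul_le_mul_of_nonneg_left hci hη.le) 1)

theorem dropsOn_iUnion (hq : IsWeight q) (hPf : markovOp q T f ≤ f) {J : Type*} [Finite J]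
    {A : J → Set X} (hA : ∀ j, DropsOn q T f (A j)) : DropsOn q T f (⋃ j, A j) := by
  choose N η hη hN using hA
  obtain ⟨N', hN'⟩ := Finite.exists_le N
  obtain ⟨η', hη'⟩ := Finite.exists_ge fun j => (⟨η j, hη j⟩ : Set.Ioi (0 : ℝ))
  refine ⟨N', η', η'.2, fun x hx => ?_⟩
  obtain ⟨j, hj⟩ := Set.mem_iUnion.1 hx
  calc (markovOp q T)^[N'] f x
      ≤ (markovOp q T)^[N j] f x := hq.monotone_markovOp.antitone_iterate_of_map_le hPf (hN' j) x
    _ ≤ 1 - η j := hN j x hj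
    _ ≤ 1 - η' := sub_le_sub_left (Subtype.coe_le_coe.2 (hη' j)) 1

end IsWeight

end MarkovOp

section ContractiveIFS

variable {ι X : Type*} [Fintype ι] [PseudoMetricSpace X]

/-- An iterated function system with place-dependent probabilities: the maps `T i` are
`b`-Lipschitz, and the weights `q i` with which they are chosen are `L`-Lipschitz. -/
structure IsLipschitzIFS (q : ι → X → ℝ) (T : ι → X → X) (b L : ℝ≥0) : Prop
    extends IsWeight q where
  lipschitz_map : ∀ i, LipschitzWith b (T i)
  lipschitz_weight : ∀ i, LipschitzWith L (q i)

/-- The function `f` is `o`-Lipschitz for the truncated distance `min 1 (A * dist x y)`. -/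
structure TruncLipschitz (A o : ℝ) (f : X → ℝ) : Prop where
  sub_le : ∀ x y, f x - f y ≤ o
  sub_le_mul_dist : ∀ x y, f x - f y ≤ A * o * dist x y

variable {q : ι → X → ℝ} {T : ι → X → X} {b L : ℝ≥0} {f : X → ℝ} {A o ρ : ℝ}

theorem TruncLipschitz.nonneg (hf : TruncLipschitz A o f) (x : X) : 0 ≤ o := by
  simpa using hf.sub_le x x

namespace IsLipschitzIFS

theorem dist_map_le (hP : IsLipschitzIFS q T b L) (i : ι) (x y : X) :
    dist (T i x) (T i y) ≤ b * dist x y :=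
  (hP.lipschitz_map i).dist_le_mul x y

theorem markovOp_sub_le_mul_dist (hP : IsLipschitzIFS q T b L) {K : ℝ} (hK : 0 ≤ K)
    (hfK : ∀ x y, f x - f y ≤ K * dist x y) (ho : ∀ x y, f x - f y ≤ o) (x y : X) :
    markovOp q T f x - markovOp q T f y ≤ (b * K + Fintype.card ι * L * o) * dist x y := by
  have maps_le : ∑ i, q i x * (f (T i x) - f (T i y)) ≤ b * K * dist x y := by
    calc ∑ i, q i x * (f (T i x) - f (T i y))
        ≤ ∑ i, q i x * (b * K * dist x y) := by
          refine Finset.sum_le_sum fun i _ => mul_le_mul_of_nonneg_left ?_ (hP.nonneg i x)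
          calc f (T i x) - f (T i y) ≤ K * dist (T i x) (T i y) := hfK _ _
            _ ≤ K * (b * dist x y) := mul_le_mul_of_nonneg_left (hP.dist_map_le i x y) hK
            _ = b * K * dist x y := by ring
      _ = b * K * dist x y := by rw [← Finset.sum_mul, hP.sum_eq_one, one_mul]
  have weights_le :
      ∑ i, (q i x - q i y) * (f (T i y) - f y) ≤ Fintype.card ι * L * o * dist x y := by
    calc ∑ i, (q i x - q i y) * (f (T i y) - f y)
        ≤ ∑ _i : ι, L * dist x y * o := by
          refine Finset.sum_le_sum fun i _ => (le_abs_self _).trans ?_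
          rw [abs_mul]
          exact mul_le_mul ((hP.lipschitz_weight i).dist_le_mul x y)
            (abs_sub_le_iff.2 ⟨ho _ _, ho _ _⟩) (abs_nonneg _) (by positivity)
      _ = Fintype.card ι * L * o * dist x y := by
          rw [Finset.sum_const, Finset.card_univ, nsmul_eq_mul]
          ring
  have sum_sub_mul : ∑ i, (q i x - q i y) * f y = 0 := by
    rw [← Finset.sum_mul, Finset.sum_sub_distrib, hP.sum_eq_one, hP.sum_eq_one, sub_self, zero_mul]
  have split : markovOp q T f x - markovOp q T f y = ∑ i, q i x * (f (T i x) - f (T i y)) +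
      ∑ i, (q i x - q i y) * (f (T i y) - f y) := by
    rw [← sub_zero (_ - _), ← sum_sub_mul]
    simp only [markovOp, ← Finset.sum_sub_distrib, ← Finset.sum_add_distrib]
    exact Finset.sum_congr rfl fun i _ => by ring
  linarith

theorem markovOp_sub_le_of_truncLipschitz (hP : IsLipschitzIFS q T b L) (hA : 0 ≤ A)
    (hρ : b * A + Fintype.card ι * L ≤ ρ * A) (hf : TruncLipschitz A o f) (x y : X) :
    markovOp q T f x - markovOp q T f y ≤ A * (ρ * o) * dist x y := by
  have ho := hf.nonneg x
  refine (hP.markovOp_sub_le_mul_dist (mul_nonneg hA ho) hf.sub_le_mul_dist hf.sub_le x y).trans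
    (mul_le_mul_of_nonneg_right ?_ dist_nonneg)
  linarith [mul_le_mul_of_nonneg_right hρ ho]

theorem truncLipschitz_iterate_markovOp (hP : IsLipschitzIFS q T b L) (hA : 0 ≤ A)
    (hbA : b * A + Fintype.card ι * L ≤ A) (hf : TruncLipschitz A o f) (n : ℕ) :
    TruncLipschitz A o ((markovOp q T)^[n] f) := by
  refine ⟨hP.iterate_markovOp_sub_le hf.sub_le n, ?_⟩
  induction n with
  | zero => exact hf.sub_le_mul_dist
  | succ n ih =>
    intro x y
    rw [Function.iterate_succ_apply']
    simpa using hP.markovOp_sub_le_of_truncLipschitz (ρ := 1) hA (by simpa using hbA)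
      ⟨hP.iterate_markovOp_sub_le hf.sub_le n, ih⟩ x y

theorem iterate_markovOp_sub_le_coupling (hP : IsLipschitzIFS q T b L) {K η : ℝ} (hη : 0 ≤ η)
    (hηq : ∀ i x, η ≤ q i x) (hK : 0 ≤ K) (hfK : ∀ x y, f x - f y ≤ K * dist x y)
    (ho : ∀ x y, f x - f y ≤ o) (n : ℕ) (x y : X) :
    (markovOp q T)^[n] f x - (markovOp q T)^[n] f y ≤
      (Fintype.card ι * η) ^ n * (K * b ^ n * dist x y) + (1 - (Fintype.card ι * η) ^ n) * o := by
  set θ : ℝ := Fintype.card ι * η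
  induction n generalizing x y with
  | zero => simpa using hfK x y
  | succ n ih =>
    rw [Function.iterate_succ_apply']
    refine (hP.markovOp_sub_le_coupling hη hηq (hP.iterate_markovOp_sub_le ho n)
      (r := θ ^ n * (K * b ^ n * (b * dist x y)) + (1 - θ ^ n) * o)
      fun i => (ih _ _).trans ?_).trans_eq (by ring)
    gcongr
    exact hP.dist_map_le i x y

theorem truncLipschitz_contraction (hP : IsLipschitzIFS q T b L) {D η : ℝ}
    (hD : ∀ x y : X, dist x y ≤ D) (hη : 0 ≤ η) (hηq : ∀ i x, η ≤ q i x) (hA : 0 ≤ A)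
    (hρ : b * A + Fintype.card ι * L ≤ ρ * A) (hρ_one : ρ ≤ 1) {n : ℕ}
    (hn : A * b ^ (n + 1) * D ≤ 1 / 2) (hf : TruncLipschitz A o f) :
    TruncLipschitz A (max ρ (1 - (Fintype.card ι * η) ^ (n + 1) / 2) * o)
      ((markovOp q T)^[n + 1] f) := by
  constructor <;> intro x y <;> have ho := hf.nonneg x
  · have half_le : A * o * b ^ (n + 1) * dist x y ≤ 1 / 2 * o := by
      calc A * o * b ^ (n + 1) * dist x y
          ≤ A * o * b ^ (n + 1) * D := by gcongr; exact hD x y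
        _ = A * b ^ (n + 1) * D * o := by ring
        _ ≤ 1 / 2 * o := by gcongr
    calc (markovOp q T)^[n + 1] f x - (markovOp q T)^[n + 1] f y
        ≤ (Fintype.card ι * η) ^ (n + 1) * (A * o * b ^ (n + 1) * dist x y) +
            (1 - (Fintype.card ι * η) ^ (n + 1)) * o :=
          hP.iterate_markovOp_sub_le_coupling hη hηq (by positivity) hf.sub_le_mul_dist hf.sub_le
            _ x y
      _ ≤ (Fintype.card ι * η) ^ (n + 1) * (1 / 2 * o) +
            (1 - (Fintype.card ι * η) ^ (n + 1)) * o := by gcongr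
      _ = (1 - (Fintype.card ι * η) ^ (n + 1) / 2) * o := by ring
      _ ≤ _ := by gcongr; exact le_max_right _ _
  · have hbA : b * A + Fintype.card ι * L ≤ A := hρ.trans (mul_le_of_le_one_left hA hρ_one)
    rw [Function.iterate_succ_apply']
    refine (hP.markovOp_sub_le_of_truncLipschitz hA hρ
      (hP.truncLipschitz_iterate_markovOp hA hbA hf n) x y).trans ?_
    gcongr
    exact le_max_left _ _

theorem exists_truncLipschitz_contraction [BoundedSpace X] [Nonempty X]
    (hP : IsLipschitzIFS q T b L) (hb : b < 1) {η : ℝ} (hη : 0 < η) (hηq : ∀ i x, η ≤ q i x) :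
    ∃ A ≥ 1, ∃ γ ∈ Set.Ico (0 : ℝ) 1, ∃ N : ℕ, ∀ (f : X → ℝ) (o : ℝ), TruncLipschitz A o f →
      TruncLipschitz A (γ * o) ((markovOp q T)^[N] f) := by
  have hb' : (b : ℝ) < 1 := hb
  have one_sub_b_pos : 0 < 1 - (b : ℝ) := sub_pos.2 hb'
  set A : ℝ := 2 * (Fintype.card ι * L) / (1 - b) + 1 with hA
  have one_le_A : 1 ≤ A := le_add_of_nonneg_left (by positivity)
  have hρ : b * A + Fintype.card ι * L ≤ (1 + b) / 2 * A := by
    have hAb : (A - 1) * (1 - b) = 2 * (Fintype.card ι * L) := by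
      rw [hA, add_sub_cancel_right, div_mul_cancel₀ _ one_sub_b_pos.ne']
    linarith
  obtain ⟨n, hn⟩ : ∃ n : ℕ, A * (b : ℝ) ^ (n + 1) * Metric.diam (Set.univ : Set X) ≤ 1 / 2 := by
    have hlim : Tendsto (fun n : ℕ => A * (b : ℝ) ^ (n + 1) * Metric.diam (Set.univ : Set X))
        atTop (𝓝 0) := by
      simpa using ((((tendsto_pow_atTop_nhds_zero_of_lt_one b.2 hb').comp
        (tendsto_add_atTop_nat 1)).const_mul A).mul_const (Metric.diam (Set.univ : Set X)))
    exact (hlim.eventually_le_const one_half_pos).exists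
  have : Nonempty ι := by
    by_contra hι
    simpa [not_nonempty_iff.1 hι] using hP.sum_eq_one (Classical.arbitrary X)
  refine ⟨A, one_le_A, _, ⟨le_max_of_le_left (by positivity), max_lt (by linarith) ?_⟩, n + 1,
    fun f o hf => hP.truncLipschitz_contraction (fun x y =>
      Metric.dist_le_diam_of_mem (Bornology.IsBounded.all _) (Set.mem_univ x) (Set.mem_univ y))
      hη.le hηq (zero_le_one.trans one_le_A) hρ (by linarith) hn hf⟩
  have : 0 < (Fintype.card ι * η) ^ (n + 1) :=
    pow_pos (mul_pos (Nat.cast_pos.2 Fintype.card_pos) hη) _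
  linarith

theorem asymptoticallyConstant [BoundedSpace X] (hP : IsLipschitzIFS q T b L) (hb : b < 1)
    {η : ℝ} (hη : 0 < η) (hηq : ∀ i x, η ≤ q i x) {K : ℝ≥0} (hf : LipschitzWith K f) :
    AsymptoticallyConstant q T f := by
  intro e he
  rcases isEmpty_or_nonempty X with hX | hX
  · exact Eventually.of_forall fun _ x => isEmptyElim x
  obtain ⟨A, one_le_A, γ, ⟨hγ₀, hγ₁⟩, N, hcontr⟩ := hP.exists_truncLipschitz_contraction hb hη hηq
  have sub_le (x y : X) : f x - f y ≤ K * dist x y :=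
    (le_abs_self _).trans (hf.dist_le_mul x y)
  set D := Metric.diam (Set.univ : Set X)
  set o : ℝ := K * D + K
  have initial : TruncLipschitz A o f := by
    refine ⟨fun x y => (sub_le x y).trans ?_, fun x y => (sub_le x y).trans ?_⟩
    · refine le_add_of_le_of_nonneg (mul_le_mul_of_nonneg_left ?_ K.2) K.2
      exact Metric.dist_le_diam_of_mem (Bornology.IsBounded.all _) trivial trivial
    · gcongr
      have : 0 ≤ D := Metric.diam_nonneg
      exact (le_add_of_nonneg_left (by positivity)).trans
        (le_mul_of_one_le_left (by positivity) one_le_A)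
  have iterated (i : ℕ) : TruncLipschitz A (γ ^ i * o) ((markovOp q T)^[N * i] f) := by
    induction i with
    | zero => simpa using initial
    | succ i ih =>
      rw [mul_add_one, add_comm (N * i), Function.iterate_add_apply, pow_succ', mul_assoc]
      exact hcontr _ _ ih
  obtain ⟨i, hi⟩ : ∃ i : ℕ, γ ^ i * o ≤ e := by
    have hlim := (tendsto_pow_atTop_nhds_zero_of_lt_one hγ₀ hγ₁).mul_const o
    rw [zero_mul] at hlim
    exact (hlim.eventually_le_const he).exists
  filter_upwards [eventually_ge_atTop (N * i)] with n hn
  obtain ⟨l, rfl⟩ := Nat.exists_eq_add_of_le' hn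
  rw [Function.iterate_add_apply]
  exact hP.iterate_markovOp_sub_le (fun x y => ((iterated i).sub_le x y).trans hi) l

end IsLipschitzIFS

end ContractiveIFS

section FellerChain

variable {ι X : Type*} [Fintype ι] [TopologicalSpace X] [MeasurableSpace X]

/-- `κ` is the transition kernel of the Feller chain that moves from `x` to `T i x` with
probability `q i x`. -/
structure IsIFSKernel (κ : Kernel X X) (q : ι → X → ℝ) (T : ι → X → X) : Prop
    extends IsWeight q where
  continuous_weight : ∀ i, Continuous (q i)
  continuous_map : ∀ i, Continuous (T i)
  apply_eq : ∀ x, κ x = ∑ i, ENNReal.ofReal (q i x) • Measure.dirac (T i x)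

variable {q : ι → X → ℝ} {T : ι → X → X} {κ : Kernel X X} {f : X → ℝ}

namespace IsIFSKernel

theorem continuous_iterate (hκ : IsIFSKernel κ q T) (hf : Continuous f) (n : ℕ) :
    Continuous ((markovOp q T)^[n] f) :=
  continuous_iterate_markovOp hκ.continuous_weight hκ.continuous_map hf n

theorem isMarkovKernel (hκ : IsIFSKernel κ q T) : IsMarkovKernel κ := by
  refine ⟨fun x => ⟨?_⟩⟩
  simp only [hκ.apply_eq, Measure.finsetSum_apply, Measure.smul_apply, measure_univ, smul_eq_mul,
    mul_one]
  rw [← ENNReal.ofReal_sum_of_nonneg fun i _ => hκ.nonneg i x, hκ.sum_eq_one, ENNReal.ofReal_one]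

end IsIFSKernel

variable [CompactSpace X] [OpensMeasurableSpace X]

theorem integrable_of_continuous {μ : Measure X} [IsFiniteMeasure μ] (hf : Continuous f) :
    Integrable f μ :=
  hf.integrable_of_hasCompactSupport (HasCompactSupport.of_compactSpace f)

theorem abs_integral_sub_le {μ : Measure X} [IsProbabilityMeasure μ] (hf : Continuous f) {e : ℝ}
    (he : ∀ x y, f x - f y ≤ e) (x : X) : |∫ y, f y ∂μ - f x| ≤ e := by
  have integral_sub : ∫ y, (f y - f x) ∂μ = ∫ y, f y ∂μ - f x := by
    simp [integral_sub (integrable_of_continuous hf) (integrable_const _)]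
  have norm_le := norm_integral_le_of_norm_le_const (μ := μ) (f := fun y => f y - f x)
    (.of_forall fun y => abs_sub_le_iff.2 ⟨he y x, he x y⟩)
  simpa [integral_sub] using norm_le

variable [T1Space X]

namespace IsIFSKernel

theorem integral_apply (hκ : IsIFSKernel κ q T) (hf : Continuous f) (x : X) :
    ∫ y, f y ∂(κ x) = markovOp q T f x := by
  rw [hκ.apply_eq, integral_finsetSum_measure fun i _ =>
    (integrable_of_continuous hf).smul_measure ENNReal.ofReal_ne_top]
  refine Finset.sum_congr rfl fun i _ => ?_
  rw [integral_smul_measure, integral_dirac, ENNReal.toReal_ofReal (hκ.nonneg i x), smul_eq_mul]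

theorem integral_bind (hκ : IsIFSKernel κ q T) (μ : Measure X) [IsFiniteMeasure μ]
    (hf : Continuous f) : ∫ y, f y ∂(μ.bind κ) = ∫ x, markovOp q T f x ∂μ := by
  have := hκ.isMarkovKernel
  rw [Measure.comp_eq_comp_const_apply, Kernel.integral_comp (integrable_of_continuous hf),
    Kernel.const_apply]
  simp only [hκ.integral_apply hf]

theorem integral_iterate_of_invariant (hκ : IsIFSKernel κ q T) {μ : Measure X}
    [IsFiniteMeasure μ] (hμ : κ.Invariant μ) (hf : Continuous f) (n : ℕ) :
    ∫ x, (markovOp q T)^[n] f x ∂μ = ∫ x, f x ∂μ := by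
  induction n with
  | zero => rfl
  | succ n ih =>
    rw [← ih, Function.iterate_succ_apply', ← hκ.integral_bind μ (hκ.continuous_iterate hf n),
      hμ.def]

theorem tendsto_iterate_of_invariant (hκ : IsIFSKernel κ q T) {μ : Measure X}
    [IsProbabilityMeasure μ] (hμ : κ.Invariant μ) (hf : Continuous f)
    (hosc : AsymptoticallyConstant q T f) (x : X) :
    Tendsto (fun n => (markovOp q T)^[n] f x) atTop (𝓝 (∫ y, f y ∂μ)) := by
  refine Metric.tendsto_nhds.2 fun e he => ?_
  filter_upwards [hosc (e / 2) (half_pos he)] with n hn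
  rw [dist_comm, Real.dist_eq, ← hκ.integral_iterate_of_invariant hμ hf n]
  exact (abs_integral_sub_le (hκ.continuous_iterate hf n) hn x).trans_lt (half_lt_self he)

theorem tendsto_iterate_succ_sub (hκ : IsIFSKernel κ q T) (hf : Continuous f)
    (hosc : AsymptoticallyConstant q T f) (x : X) :
    Tendsto (fun n => (markovOp q T)^[n] (markovOp q T f) x - (markovOp q T)^[n] f x) atTop
      (𝓝 0) := by
  have := hκ.isMarkovKernel
  refine Metric.tendsto_nhds.2 fun e he => ?_
  filter_upwards [hosc (e / 2) (half_pos he)] with n hn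
  rw [Real.dist_eq, sub_zero, ← Function.iterate_succ_apply, Function.iterate_succ_apply',
    ← hκ.integral_apply (hκ.continuous_iterate hf n)]
  exact (abs_integral_sub_le (hκ.continuous_iterate hf n) hn x).trans_lt (half_lt_self he)

theorem exists_integral_eq_iterate (hκ : IsIFSKernel κ q T) (x : X) (n : ℕ) :
    ∃ m : ProbabilityMeasure X, ∀ f : X → ℝ, Continuous f →
      ∫ y, f y ∂(m : Measure X) = (markovOp q T)^[n] f x := by
  have := hκ.isMarkovKernel
  induction n with
  | zero => exact ⟨⟨Measure.dirac x, inferInstance⟩, fun f _ => integral_dirac f x⟩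
  | succ n ih =>
    obtain ⟨m, hm⟩ := ih
    refine ⟨⟨(m : Measure X).bind κ, inferInstance⟩, fun f hf => ?_⟩
    exact (hκ.integral_bind _ hf).trans (hm _ (hκ.continuous_iterate hf 1))

-- Foster–Lyapunov: `V` decays geometrically for the chain with weights `q₀`, and the chain of `κ`
-- follows it up to an error `r` per step.
theorem one_sub_mul_integral_le (hκ : IsIFSKernel κ q T) {q₀ : ι → X → ℝ} (hq₀ : IsWeight q₀)
    {r : ℝ} (hr : ∀ x, ∑ i, |q i x - q₀ i x| ≤ r) {V : X → ℝ} (hV : Continuous V)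
    (hV_le : ∀ x, |V x| ≤ 1) {N : ℕ} {θ : ℝ} (hdecay : ∀ x, (markovOp q₀ T)^[N] V x ≤ θ * V x)
    {μ : Measure X} [IsProbabilityMeasure μ] (hμ : κ.Invariant μ) :
    (1 - θ) * ∫ x, V x ∂μ ≤ N * r := by
  have hV_int : Integrable V μ := integrable_of_continuous hV
  have integral_le : ∫ x, V x ∂μ ≤ θ * ∫ x, V x ∂μ + N * r := by
    calc ∫ x, V x ∂μ = ∫ x, (markovOp q T)^[N] V x ∂μ :=
          (hκ.integral_iterate_of_invariant hμ hV N).symm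
      _ ≤ ∫ x, (θ * V x + N * r) ∂μ :=
          integral_mono (integrable_of_continuous (hκ.continuous_iterate hV N))
            ((hV_int.const_mul θ).add (integrable_const _)) fun x =>
            (hκ.iterate_markovOp_le_add hq₀ hr hV_le N x).trans (by gcongr; exact hdecay x)
      _ = θ * ∫ x, V x ∂μ + N * r := by
          rw [integral_add (hV_int.const_mul θ) (integrable_const _), integral_const_mul]
          simp
  linarith

end IsIFSKernel

end FellerChain

section InvariantMeasure

variable {ι X : Type*} [Fintype ι] [MetricSpace X] [MeasurableSpace X] [BorelSpace X]

theorem probabilityMeasure_ext_of_lipschitz {μ ν : ProbabilityMeasure X}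
    (h : ∀ (f : X → ℝ) (K : ℝ≥0), LipschitzWith K f →
      ∫ x, f x ∂(μ : Measure X) = ∫ x, f x ∂(ν : Measure X)) :
    μ = ν := by
  have hlim : Tendsto (fun _ : ℕ => μ) atTop (𝓝 ν) := by
    rw [tendsto_iff_forall_lipschitz_integral_tendsto]
    rintro f - ⟨K, hK⟩
    rw [h f K hK]
    exact tendsto_const_nhds
  exact tendsto_nhds_unique tendsto_const_nhds hlim

variable [CompactSpace X] {q : ι → X → ℝ} {T : ι → X → X} {κ : Kernel X X}

namespace IsIFSKernel

theorem invariant_unique (hκ : IsIFSKernel κ q T)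
    (hosc : ∀ (f : X → ℝ) (K : ℝ≥0), LipschitzWith K f → AsymptoticallyConstant q T f)
    {μ ν : ProbabilityMeasure X} (hμ : κ.Invariant (μ : Measure X))
    (hν : κ.Invariant (ν : Measure X)) : μ = ν := by
  obtain ⟨x⟩ := nonempty_of_isProbabilityMeasure (μ : Measure X)
  exact probabilityMeasure_ext_of_lipschitz fun f K hf => tendsto_nhds_unique
    (hκ.tendsto_iterate_of_invariant hμ hf.continuous (hosc f K hf) x)
    (hκ.tendsto_iterate_of_invariant hν hf.continuous (hosc f K hf) x)

theorem exists_ultrafilter_tendsto_integral (hκ : IsIFSKernel κ q T) (x : X) :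
    ∃ U : Ultrafilter ℕ, (U : Filter ℕ) ≤ atTop ∧ ∃ μ : ProbabilityMeasure X,
      ∀ f : X → ℝ, Continuous f →
        Tendsto (fun n => (markovOp q T)^[n] f x) U (𝓝 (∫ y, f y ∂(μ : Measure X))) := by
  choose m hm using hκ.exists_integral_eq_iterate x
  let U : Ultrafilter ℕ := Ultrafilter.of atTop
  refine ⟨U, Ultrafilter.of_le atTop, (U.map m).lim, fun f hf => ?_⟩
  have hlim : Tendsto m U (𝓝 (U.map m).lim) := (U.map m).le_nhds_lim
  simpa [hm _ f hf] using ProbabilityMeasure.tendsto_iff_forall_integral_tendsto.1 hlim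
    (BoundedContinuousFunction.mkOfCompact ⟨f, hf⟩)

theorem exists_invariant [Nonempty X] (hκ : IsIFSKernel κ q T)
    (hosc : ∀ (f : X → ℝ) (K : ℝ≥0), LipschitzWith K f → AsymptoticallyConstant q T f) :
    ∃ μ : ProbabilityMeasure X, κ.Invariant (μ : Measure X) := by
  have := hκ.isMarkovKernel
  obtain ⟨x⟩ := ‹Nonempty X›
  obtain ⟨U, hU, μ, hμ⟩ := hκ.exists_ultrafilter_tendsto_integral x
  let μκ : ProbabilityMeasure X := ⟨(μ : Measure X).bind κ, inferInstance⟩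
  suffices μκ = μ from ⟨μ, congrArg (fun ν : ProbabilityMeasure X => (ν : Measure X)) this⟩
  refine probabilityMeasure_ext_of_lipschitz fun f K hf => sub_eq_zero.1 ?_
  have hlim := (hμ _ (hκ.continuous_iterate hf.continuous 1)).sub (hμ f hf.continuous)
  rw [← tendsto_nhds_unique hlim
    ((hκ.tendsto_iterate_succ_sub hf.continuous (hosc f K hf) x).mono_left hU)]
  exact congrArg (· - _) (hκ.integral_bind _ hf.continuous)

theorem existsUnique_invariant [Nonempty X] (hκ : IsIFSKernel κ q T) {b L : ℝ≥0}
    (hP : IsLipschitzIFS q T b L) (hb : b < 1) {η : ℝ} (hη : 0 < η) (hηq : ∀ i x, η ≤ q i x) :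
    ∃! μ : ProbabilityMeasure X, κ.Invariant (μ : Measure X) := by
  have hosc (f : X → ℝ) (K : ℝ≥0) (hf : LipschitzWith K f) : AsymptoticallyConstant q T f :=
    hP.asymptoticallyConstant hb hη hηq hf
  obtain ⟨μ, hμ⟩ := hκ.exists_invariant hosc
  exact ⟨μ, hμ, fun ν hν => hκ.invariant_unique hosc hν hμ⟩

end IsIFSKernel

end InvariantMeasure

section PlayProb

variable {A B : Type*} [Fintype A] [Fintype B]

theorem bestReplies_nonempty [Nonempty A] (π : A → B → ℝ) (σ : B → ℝ) :
    (bestReplies π σ).Nonempty := by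
  obtain ⟨a, -, ha⟩ := Finset.exists_max_image Finset.univ (fun a => expectedPayoff π a σ)
    Finset.univ_nonempty
  exact ⟨a, by simpa [bestReplies] using ha⟩

theorem sum_prod_sample (k : ℕ) (p : stdSimplex ℝ B) (C : Finset B) :
    ∑ ω ∈ Fintype.piFinset fun _ : Fin k => C, ∏ j, p.1 (ω j) = (∑ b ∈ C, p.1 b) ^ k := by
  simpa using (Finset.prod_univ_sum (fun _ : Fin k => C) fun _ b => p.1 b).symm

theorem sum_prod_sample_univ (k : ℕ) (p : stdSimplex ℝ B) :
    ∑ ω : Fin k → B, ∏ j, p.1 (ω j) = 1 := by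
  simpa [p.2.2] using sum_prod_sample k p Finset.univ

theorem prod_sample_nonneg {k : ℕ} (p : stdSimplex ℝ B) (ω : Fin k → B) : 0 ≤ ∏ j, p.1 (ω j) :=
  Finset.prod_nonneg fun j _ => p.2.1 (ω j)

theorem abs_mul_sub_mul_le {a b a' b' : ℝ} (ha : |a| ≤ 1) (hb' : |b'| ≤ 1) :
    |a * b - a' * b'| ≤ |a - a'| + |b - b'| := by
  calc |a * b - a' * b'| = |(a - a') * b' + a * (b - b')| := by ring_nf
    _ ≤ |(a - a') * b'| + |a * (b - b')| := abs_add_le _ _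
    _ ≤ |a - a'| + |b - b'| := by
        rw [abs_mul, abs_mul]
        exact add_le_add (mul_le_of_le_one_right (abs_nonneg _) hb')
          (mul_le_of_le_one_left (abs_nonneg _) ha)

theorem abs_prod_sub_prod_le {ι : Type*} (s : Finset ι) {x y : ι → ℝ} (hx : ∀ i, |x i| ≤ 1)
    (hy : ∀ i, |y i| ≤ 1) : |∏ i ∈ s, x i - ∏ i ∈ s, y i| ≤ ∑ i ∈ s, |x i - y i| := by
  classical
  induction s using Finset.induction_on with
  | empty => simp
  | insert i s hi ih =>
    rw [Finset.prod_insert hi, Finset.prod_insert hi, Finset.sum_insert hi]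
    have abs_prod_le : |∏ j ∈ s, y j| ≤ 1 := by
      rw [Finset.abs_prod]
      exact Finset.prod_le_one (fun j _ => abs_nonneg _) fun j _ => hy j
    exact (abs_mul_sub_mul_le (hx i) abs_prod_le).trans (add_le_add_right ih _)

theorem abs_prod_sample_sub_le {k : ℕ} (p p' : stdSimplex ℝ B) (ω : Fin k → B) :
    |∏ j, p.1 (ω j) - ∏ j, p'.1 (ω j)| ≤ k * dist p p' := by
  have abs_le_one (r : stdSimplex ℝ B) (b : B) : |r.1 b| ≤ 1 := by
    rw [abs_of_nonneg (r.2.1 b)]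
    exact stdSimplex.le_one r b
  calc |∏ j, p.1 (ω j) - ∏ j, p'.1 (ω j)|
      ≤ ∑ j, |p.1 (ω j) - p'.1 (ω j)| :=
        abs_prod_sub_prod_le _ (fun j => abs_le_one p (ω j)) fun j => abs_le_one p' (ω j)
    _ ≤ ∑ _j : Fin k, dist p p' := Finset.sum_le_sum fun j _ => dist_le_pi_dist p.1 p'.1 (ω j)
    _ = k * dist p p' := by simp

variable [DecidableEq A]

/-- The probability of `a` when an action is chosen uniformly among the best replies to `σ`. -/
noncomputable def replyWeight (π : A → B → ℝ) (σ : B → ℝ) (a : A) : ℝ :=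
  if a ∈ bestReplies π σ then 1 / ((bestReplies π σ).card : ℝ) else 0

theorem replyWeight_nonneg (π : A → B → ℝ) (σ : B → ℝ) (a : A) : 0 ≤ replyWeight π σ a := by
  unfold replyWeight
  split_ifs <;> positivity

theorem sum_replyWeight_of_bestReplies_subset [Nonempty A] {π : A → B → ℝ} {σ : B → ℝ}
    {C : Finset A} (hC : bestReplies π σ ⊆ C) : ∑ a ∈ C, replyWeight π σ a = 1 := by
  have card_ne_zero : ((bestReplies π σ).card : ℝ) ≠ 0 :=
    Nat.cast_ne_zero.2 (bestReplies_nonempty π σ).card_ne_zero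
  unfold replyWeight
  rw [Finset.sum_ite_mem, Finset.inter_eq_right.2 hC, Finset.sum_const, nsmul_eq_mul,
    mul_one_div_cancel card_ne_zero]

theorem replyWeight_le_one (π : A → B → ℝ) (σ : B → ℝ) (a : A) : replyWeight π σ a ≤ 1 := by
  unfold replyWeight
  split_ifs
  · simpa using Nat.cast_inv_le_one _
  · exact zero_le_one

variable [DecidableEq B]

theorem bestReplyProb_eq_sum (π : A → B → ℝ) (k : ℕ) (p : stdSimplex ℝ B) (a : A) :
    bestReplyProb π k p a =
      ∑ ω : Fin k → B, (∏ j, p.1 (ω j)) * replyWeight π (empirical ω) a :=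
  rfl

theorem bestReplyProb_nonneg (π : A → B → ℝ) (k : ℕ) (p : stdSimplex ℝ B) (a : A) :
    0 ≤ bestReplyProb π k p a :=
  Finset.sum_nonneg fun ω _ => mul_nonneg (prod_sample_nonneg p ω) (replyWeight_nonneg _ _ _)

theorem bestReplyProb_le_one (π : A → B → ℝ) (k : ℕ) (p : stdSimplex ℝ B) (a : A) :
    bestReplyProb π k p a ≤ 1 := by
  rw [bestReplyProb_eq_sum, ← sum_prod_sample_univ k p]
  exact Finset.sum_le_sum fun ω _ =>
    mul_le_of_le_one_right (prod_sample_nonneg p ω) (replyWeight_le_one _ _ _)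

theorem sum_bestReplyProb [Nonempty A] (π : A → B → ℝ) (k : ℕ) (p : stdSimplex ℝ B) :
    ∑ a, bestReplyProb π k p a = 1 := by
  simp only [bestReplyProb_eq_sum]
  rw [Finset.sum_comm, ← sum_prod_sample_univ k p]
  refine Finset.sum_congr rfl fun ω _ => ?_
  rw [← Finset.mul_sum, sum_replyWeight_of_bestReplies_subset (Finset.subset_univ _), mul_one]

theorem abs_bestReplyProb_sub_le (π : A → B → ℝ) (k : ℕ) (p p' : stdSimplex ℝ B) (a : A) :
    |bestReplyProb π k p a - bestReplyProb π k p' a| ≤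
      Fintype.card (Fin k → B) * k * dist p p' := by
  calc |bestReplyProb π k p a - bestReplyProb π k p' a|
      = |∑ ω : Fin k → B, (∏ j, p.1 (ω j) - ∏ j, p'.1 (ω j)) * replyWeight π (empirical ω) a| := by
        simp only [bestReplyProb_eq_sum, ← Finset.sum_sub_distrib, sub_mul]
    _ ≤ ∑ _ω : Fin k → B, k * dist p p' := by
        refine (Finset.abs_sum_le_sum_abs _ _).trans (Finset.sum_le_sum fun ω _ => ?_)
        rw [abs_mul, abs_of_nonneg (replyWeight_nonneg _ _ _)]
        exact (mul_le_of_le_one_right (abs_nonneg _) (replyWeight_le_one _ _ _)).trans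
          (abs_prod_sample_sub_le p p' ω)
    _ = Fintype.card (Fin k → B) * k * dist p p' := by
        rw [Finset.sum_const, Finset.card_univ, nsmul_eq_mul, mul_assoc]

theorem playProb_zero (π : A → B → ℝ) (k : ℕ) (p : stdSimplex ℝ B) (a : A) :
    playProb π k 0 p a = bestReplyProb π k p a := by
  simp [playProb]

theorem sum_playProb [Nonempty A] (π : A → B → ℝ) (k : ℕ) (ε : ℝ) (p : stdSimplex ℝ B) :
    ∑ a, playProb π k ε p a = 1 := by
  have card_ne_zero : (Fintype.card A : ℝ) ≠ 0 := Nat.cast_ne_zero.2 Fintype.card_ne_zero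
  simp only [playProb]
  rw [Finset.sum_add_distrib, ← Finset.mul_sum, sum_bestReplyProb, Finset.sum_const,
    Finset.card_univ, nsmul_eq_mul, mul_div_cancel₀ _ card_ne_zero]
  ring

theorem div_card_le_playProb (π : A → B → ℝ) (k : ℕ) {ε : ℝ} (hε : ε ≤ 1)
    (p : stdSimplex ℝ B) (a : A) : ε / Fintype.card A ≤ playProb π k ε p a :=
  le_add_of_nonneg_left (mul_nonneg (sub_nonneg.2 hε) (bestReplyProb_nonneg π k p a))

theorem playProb_nonneg (π : A → B → ℝ) (k : ℕ) {ε : ℝ} (hε : ε ∈ Set.Icc (0 : ℝ) 1)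
    (p : stdSimplex ℝ B) (a : A) : 0 ≤ playProb π k ε p a :=
  (div_nonneg hε.1 (Nat.cast_nonneg _)).trans (div_card_le_playProb π k hε.2 p a)

theorem abs_playProb_le_one [Nonempty A] (π : A → B → ℝ) (k : ℕ) {ε : ℝ}
    (hε : ε ∈ Set.Icc (0 : ℝ) 1) (p : stdSimplex ℝ B) (a : A) : |playProb π k ε p a| ≤ 1 := by
  rw [abs_of_nonneg (playProb_nonneg π k hε p a), ← sum_playProb π k ε p]
  exact Finset.single_le_sum (fun a _ => playProb_nonneg π k hε p a) (Finset.mem_univ a)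

theorem abs_playProb_sub_le (π : A → B → ℝ) (k : ℕ) {ε : ℝ} (hε : ε ∈ Set.Icc (0 : ℝ) 1)
    (p p' : stdSimplex ℝ B) (a : A) :
    |playProb π k ε p a - playProb π k ε p' a| ≤ Fintype.card (Fin k → B) * k * dist p p' := by
  have sub_eq : playProb π k ε p a - playProb π k ε p' a =
      (1 - ε) * (bestReplyProb π k p a - bestReplyProb π k p' a) := by
    unfold playProb
    ring
  rw [sub_eq, abs_mul, abs_of_nonneg (sub_nonneg.2 hε.2)]
  exact (mul_le_of_le_one_left (abs_nonneg _) (sub_le_self 1 hε.1)).trans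
    (abs_bestReplyProb_sub_le π k p p' a)

theorem abs_playProb_sub_playProb_zero_le (π : A → B → ℝ) (k : ℕ) {ε : ℝ} (hε : 0 ≤ ε)
    (p : stdSimplex ℝ B) (a : A) : |playProb π k ε p a - playProb π k 0 p a| ≤ ε := by
  have sub_eq : playProb π k ε p a - playProb π k 0 p a =
      ε * (1 / (Fintype.card A : ℝ) - bestReplyProb π k p a) := by
    unfold playProb
    ring
  rw [sub_eq, abs_mul, abs_of_nonneg hε]
  refine mul_le_of_le_one_right hε (abs_sub_le_iff.2 ⟨?_, ?_⟩)
  · exact (sub_le_self _ (bestReplyProb_nonneg π k p a)).trans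
      (by simpa using Nat.cast_inv_le_one (Fintype.card A))
  · exact (sub_le_self _ (by positivity)).trans (bestReplyProb_le_one π k p a)

end PlayProb

section Update

variable {A : Type*} [Fintype A] [DecidableEq A] (β : unitInterval) (p : stdSimplex ℝ A)

theorem update_apply (s a : A) :
    (update β p s).1 a = β * p.1 a + (1 - β) * unitVec s a :=
  rfl

theorem dist_update_le (s : A) (p' : stdSimplex ℝ A) :
    dist (update β p s) (update β p' s) ≤ β * dist p p' := by
  rw [Subtype.dist_eq, dist_pi_le_iff (mul_nonneg β.2.1 dist_nonneg)]
  intro a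
  rw [Real.dist_eq, update_apply, update_apply, add_sub_add_right_eq_sub, ← mul_sub, abs_mul,
    abs_of_nonneg β.2.1]
  exact mul_le_mul_of_nonneg_left (dist_le_pi_dist p.1 p'.1 a) β.2.1

theorem mul_apply_le_update (s a : A) : β * p.1 a ≤ (update β p s).1 a := by
  have unitVec_nonneg : (0 : ℝ) ≤ unitVec s a := by unfold unitVec; split_ifs <;> norm_num
  exact le_add_of_nonneg_right (mul_nonneg (sub_nonneg.2 β.2.2) unitVec_nonneg)

theorem one_sub_le_update_self (s : A) : 1 - (β : ℝ) ≤ (update β p s).1 s := by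
  simpa [update_apply, unitVec] using mul_nonneg β.2.1 (p.2.1 s)

theorem min_le_update_of_mem_insert {E : Finset A} {c : ℝ} (hc : ∀ a ∈ E, c ≤ p.1 a) (s : A) :
    ∀ a ∈ insert s E, min (β * c) (1 - β) ≤ (update β p s).1 a := by
  intro a ha
  obtain rfl | ha := Finset.mem_insert.1 ha
  · exact (min_le_right _ _).trans (one_sub_le_update_self β p a)
  · exact ((min_le_left _ _).trans (mul_le_mul_of_nonneg_left (hc a ha) β.2.1)).trans
      (mul_apply_le_update β p s a)

theorem one_sub_sum_update {C : Finset A} {s : A} (hs : s ∈ C) :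
    1 - ∑ a ∈ C, (update β p s).1 a = β * (1 - ∑ a ∈ C, p.1 a) := by
  have sum_unitVec : ∑ a ∈ C, unitVec s a = 1 := by simp [unitVec, hs]
  simp only [update_apply]
  rw [Finset.sum_add_distrib, ← Finset.mul_sum, ← Finset.mul_sum, sum_unitVec]
  ring

end Update

section Samples

variable {A B : Type*}

theorem exists_one_div_card_le [Fintype A] [Nonempty A] (p : stdSimplex ℝ A) :
    ∃ a, 1 / (Fintype.card A : ℝ) ≤ p.1 a := by
  obtain ⟨a, -, ha⟩ := Finset.exists_le_of_sum_le (s := Finset.univ)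
    (f := fun _ => 1 / (Fintype.card A : ℝ)) (g := p.1) Finset.univ_nonempty (by simp [p.2.2])
  exact ⟨a, ha⟩

theorem one_sub_sum_nonneg [Fintype B] (p : stdSimplex ℝ B) (C : Finset B) :
    0 ≤ 1 - ∑ b ∈ C, p.1 b := by
  rw [← p.2.2, sub_nonneg]
  exact Finset.sum_le_univ_sum_of_nonneg p.2.1

variable [DecidableEq B] {k : ℕ}

theorem empirical_apply (ω : Fin k → B) (b : B) :
    empirical ω b = ((Finset.univ.filter fun j => ω j = b).card : ℝ) / k := by
  simp only [empirical, unitVec, eq_comm (a := b), Finset.sum_boole]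
  ring

variable [Fintype B]

theorem empirical_mem_lattice {C : Finset B} {ω : Fin k → B} (hω : ∀ j, ω j ∈ C) :
    empirical ω ∈ lattice k C := by
  refine ⟨⟨fun b => (Finset.univ.filter fun j => ω j = b).card, ?_, empirical_apply ω⟩,
    fun b hb => ?_⟩
  · rw [← Finset.card_eq_sum_card_fiberwise fun j _ => Finset.mem_coe.2 (Finset.mem_univ (ω j)),
      Finset.card_fin]
  · have not_sampled : (Finset.univ.filter fun j => ω j = b) = ∅ :=
      Finset.filter_eq_empty_iff.2 fun j _ hj => hb (hj ▸ hω j)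
    rw [empirical_apply, not_sampled, Finset.card_empty, Nat.cast_zero, zero_div]

theorem lattice_nonempty {S : Type*} [Fintype S] {C : Finset S} (hC : C.Nonempty) :
    (lattice k C).Nonempty := by
  classical
  exact ⟨_, empirical_mem_lattice fun _ : Fin k => hC.choose_spec⟩

theorem exists_empirical_eq (hk : 1 ≤ k) {C : Finset B} {σ : B → ℝ} (hσ : σ ∈ lattice k C) :
    ∃ ω : Fin k → B, (∀ j, ω j ∈ C) ∧ empirical ω = σ := by
  obtain ⟨⟨n, sum_n, σ_eq⟩, σ_eq_zero⟩ := hσ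
  have k_ne_zero : (k : ℝ) ≠ 0 := by exact_mod_cast (by omega : k ≠ 0)
  have e : Fin k ≃ Σ b, Fin (n b) := Fintype.equivOfCardEq (by simp [sum_n])
  refine ⟨fun j => (e j).1, fun j => ?_, funext fun b => ?_⟩
  · by_contra hj
    have n_eq_zero : n (e j).1 = 0 := by
      simpa [σ_eq, k_ne_zero] using σ_eq_zero _ hj
    exact (Fin.cast n_eq_zero (e j).2).elim0
  · have card_fiber : (Finset.univ.filter fun j => (e j).1 = b).card = n b := by
      calc (Finset.univ.filter fun j => (e j).1 = b).card
          = Fintype.card {x : Σ b, Fin (n b) // x.1 = b} := by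
            rw [Fintype.card_subtype]
            exact Finset.card_equiv e fun j => by simp
        _ = n b := by rw [Fintype.card_congr (Equiv.sigmaSubtype b), Fintype.card_fin]
    rw [empirical_apply, σ_eq, card_fiber]

variable [Fintype A] [DecidableEq A] (π : A → B → ℝ) (p : stdSimplex ℝ B)

theorem pow_div_card_le_bestReplyProb {c : ℝ} (hc : 0 ≤ c) {ω : Fin k → B}
    (hω : ∀ j, c ≤ p.1 (ω j)) {a : A} (ha : a ∈ bestReplies π (empirical ω)) :
    c ^ k / Fintype.card A ≤ bestReplyProb π k p a := by
  have pow_le_prod : c ^ k ≤ ∏ j, p.1 (ω j) := by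
    simpa using Finset.prod_le_prod (s := (Finset.univ : Finset (Fin k))) (f := fun _ => c)
      (fun _ _ => hc) fun j _ => hω j
  have inv_card_le : 1 / (Fintype.card A : ℝ) ≤ replyWeight π (empirical ω) a := by
    have card_pos := Finset.card_pos.2 ⟨a, ha⟩
    rw [replyWeight, if_pos ha]
    gcongr
    exact Finset.card_le_univ _
  calc c ^ k / Fintype.card A = c ^ k * (1 / Fintype.card A) := div_eq_mul_one_div _ _
    _ ≤ (∏ j, p.1 (ω j)) * replyWeight π (empirical ω) a :=
        mul_le_mul pow_le_prod inv_card_le (by positivity) (prod_sample_nonneg p ω)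
    _ ≤ bestReplyProb π k p a :=
        Finset.single_le_sum (f := fun ω => (∏ j, p.1 (ω j)) * replyWeight π (empirical ω) a)
          (fun ω _ => mul_nonneg (prod_sample_nonneg p ω) (replyWeight_nonneg _ _ _))
          (Finset.mem_univ ω)

theorem pow_div_card_le_bestReplyProb_of_mem_lattice (hk : 1 ≤ k) {c : ℝ} (hc : 0 ≤ c)
    {C : Finset B} (hp : ∀ b ∈ C, c ≤ p.1 b) {σ : B → ℝ} (hσ : σ ∈ lattice k C) {a : A}
    (ha : a ∈ bestReplies π σ) : c ^ k / Fintype.card A ≤ bestReplyProb π k p a := by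
  obtain ⟨ω, hω, rfl⟩ := exists_empirical_eq hk hσ
  exact pow_div_card_le_bestReplyProb π p hc (fun j => hp _ (hω j)) ha

variable [Nonempty A] {C : Finset A} {C' : Finset B}

theorem pow_le_sum_bestReplyProb (hC : ∀ σ ∈ lattice k C', bestReplies π σ ⊆ C) :
    (∑ b ∈ C', p.1 b) ^ k ≤ ∑ a ∈ C, bestReplyProb π k p a := by
  calc (∑ b ∈ C', p.1 b) ^ k
      = ∑ ω ∈ Fintype.piFinset fun _ : Fin k => C',
          (∏ j, p.1 (ω j)) * ∑ a ∈ C, replyWeight π (empirical ω) a := by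
        rw [← sum_prod_sample]
        refine Finset.sum_congr rfl fun ω hω => ?_
        rw [sum_replyWeight_of_bestReplies_subset
          (hC _ (empirical_mem_lattice (Fintype.mem_piFinset.1 hω))), mul_one]
    _ ≤ ∑ ω : Fin k → B, (∏ j, p.1 (ω j)) * ∑ a ∈ C, replyWeight π (empirical ω) a :=
        Finset.sum_le_univ_sum_of_nonneg fun ω => mul_nonneg (prod_sample_nonneg p ω)
          (Finset.sum_nonneg fun a _ => replyWeight_nonneg _ _ _)
    _ = ∑ a ∈ C, bestReplyProb π k p a := by
        simp only [bestReplyProb_eq_sum, Finset.mul_sum]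
        exact Finset.sum_comm

theorem one_sub_mul_le_sum_bestReplyProb (hC : ∀ σ ∈ lattice k C', bestReplies π σ ⊆ C) :
    1 - k * (1 - ∑ b ∈ C', p.1 b) ≤ ∑ a ∈ C, bestReplyProb π k p a := by
  have sum_nonneg : 0 ≤ ∑ b ∈ C', p.1 b := Finset.sum_nonneg fun b _ => p.2.1 b
  have bernoulli := one_add_mul_sub_le_pow (a := ∑ b ∈ C', p.1 b) (by linarith) k
  linarith [pow_le_sum_bestReplyProb π p hC]

theorem sum_bestReplyProb_le_one (C : Finset A) : ∑ a ∈ C, bestReplyProb π k p a ≤ 1 := by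
  rw [← sum_bestReplyProb π k p]
  exact Finset.sum_le_univ_sum_of_nonneg fun a => bestReplyProb_nonneg π k p a

end Samples

section JointPlay

variable {S₁ S₂ : Type*} [Fintype S₁] [DecidableEq S₁] [Fintype S₂] [DecidableEq S₂]

/-- The probability that the pure profile `s` is played in the state `p`. -/
noncomputable def jointProb (u₁ : S₁ → S₂ → ℝ) (u₂ : S₂ → S₁ → ℝ) (k : ℕ) (ε : ℝ)
    (s : S₁ × S₂) (p : State S₁ S₂) : ℝ :=
  playProb u₁ k ε p.2 s.1 * playProb u₂ k ε p.1 s.2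

/-- The state that follows `p` when the pure profile `s` is played. -/
noncomputable def jointUpdate (β : unitInterval) (s : S₁ × S₂) (p : State S₁ S₂) :
    State S₁ S₂ :=
  (update β p.1 s.1, update β p.2 s.2)

theorem lipschitzWith_jointUpdate (β : unitInterval) (s : S₁ × S₂) :
    LipschitzWith (unitInterval.toNNReal β) (jointUpdate β s) := by
  refine LipschitzWith.of_dist_le_mul fun p p' => max_le ?_ ?_
  · exact (dist_update_le β p.1 s.1 p'.1).trans
      (mul_le_mul_of_nonneg_left (le_max_left _ _) β.2.1)
  · exact (dist_update_le β p.2 s.2 p'.2).trans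
      (mul_le_mul_of_nonneg_left (le_max_right _ _) β.2.1)

variable (u₁ : S₁ → S₂ → ℝ) (u₂ : S₂ → S₁ → ℝ) (k : ℕ) (β : unitInterval) {ε : ℝ}

theorem div_card_mul_div_card_le_jointProb (hε : ε ∈ Set.Icc 0 1) (s : S₁ × S₂)
    (p : State S₁ S₂) :
    ε / Fintype.card S₁ * (ε / Fintype.card S₂) ≤ jointProb u₁ u₂ k ε s p :=
  mul_le_mul (div_card_le_playProb u₁ k hε.2 _ _) (div_card_le_playProb u₂ k hε.2 _ _)
    (div_nonneg hε.1 (Nat.cast_nonneg _)) (playProb_nonneg u₁ k hε _ _)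

variable [Nonempty S₁] [Nonempty S₂]

theorem isWeight_jointProb (hε : ε ∈ Set.Icc 0 1) : IsWeight (jointProb u₁ u₂ k ε) where
  nonneg s p := mul_nonneg (playProb_nonneg u₁ k hε _ _) (playProb_nonneg u₂ k hε _ _)
  sum_eq_one p := by
    rw [Fintype.sum_prod_type]
    simp only [jointProb, ← Finset.mul_sum, sum_playProb, mul_one]

theorem isWeight_jointProb_zero : IsWeight (jointProb u₁ u₂ k 0) :=
  isWeight_jointProb u₁ u₂ k ⟨le_rfl, zero_le_one⟩

theorem lipschitzWith_jointProb (hε : ε ∈ Set.Icc 0 1) (s : S₁ × S₂) :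
    LipschitzWith (Fintype.card (Fin k → S₂) * k + Fintype.card (Fin k → S₁) * k)
      (jointProb u₁ u₂ k ε s) := by
  refine LipschitzWith.of_dist_le_mul fun p p' => ?_
  push_cast
  calc |jointProb u₁ u₂ k ε s p - jointProb u₁ u₂ k ε s p'|
      ≤ |playProb u₁ k ε p.2 s.1 - playProb u₁ k ε p'.2 s.1| +
          |playProb u₂ k ε p.1 s.2 - playProb u₂ k ε p'.1 s.2| :=
        abs_mul_sub_mul_le (abs_playProb_le_one u₁ k hε _ _) (abs_playProb_le_one u₂ k hε _ _)
    _ ≤ Fintype.card (Fin k → S₂) * k * dist p.2 p'.2 +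
          Fintype.card (Fin k → S₁) * k * dist p.1 p'.1 :=
        add_le_add (abs_playProb_sub_le u₁ k hε _ _ _) (abs_playProb_sub_le u₂ k hε _ _ _)
    _ ≤ (Fintype.card (Fin k → S₂) * k + Fintype.card (Fin k → S₁) * k) * dist p p' := by
        rw [add_mul]
        gcongr
        exacts [le_max_right _ _, le_max_left _ _]

theorem sum_abs_jointProb_sub_jointProb_zero_le (hε : ε ∈ Set.Icc 0 1) (p : State S₁ S₂) :
    ∑ s, |jointProb u₁ u₂ k ε s p - jointProb u₁ u₂ k 0 s p| ≤
      Fintype.card (S₁ × S₂) * (ε + ε) := by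
  have abs_sub_le (s : S₁ × S₂) : |jointProb u₁ u₂ k ε s p - jointProb u₁ u₂ k 0 s p| ≤ ε + ε :=
    (abs_mul_sub_mul_le (abs_playProb_le_one u₁ k hε _ _)
      (abs_playProb_le_one u₂ k ⟨le_rfl, zero_le_one⟩ _ _)).trans
      (add_le_add (abs_playProb_sub_playProb_zero_le u₁ k hε.1 _ _)
        (abs_playProb_sub_playProb_zero_le u₂ k hε.1 _ _))
  simpa only [Finset.card_univ, nsmul_eq_mul] using
    Finset.sum_le_card_nsmul Finset.univ _ _ fun s _ => abs_sub_le s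

theorem isLipschitzIFS_jointProb (hε : ε ∈ Set.Icc 0 1) :
    IsLipschitzIFS (jointProb u₁ u₂ k ε) (jointUpdate β) (unitInterval.toNNReal β)
      (Fintype.card (Fin k → S₂) * k + Fintype.card (Fin k → S₁) * k) where
  toIsWeight := isWeight_jointProb u₁ u₂ k hε
  lipschitz_map := lipschitzWith_jointUpdate β
  lipschitz_weight := lipschitzWith_jointProb u₁ u₂ k hε

theorem isIFSKernel_kernel (hε : ε ∈ Set.Icc 0 1) :
    IsIFSKernel (kernel u₁ u₂ k β ε) (jointProb u₁ u₂ k ε) (jointUpdate β) where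
  toIsWeight := isWeight_jointProb u₁ u₂ k hε
  continuous_weight s := (lipschitzWith_jointProb u₁ u₂ k hε s).continuous
  continuous_map s := (lipschitzWith_jointUpdate β s).continuous
  apply_eq p := by
    rw [Fintype.sum_prod_type]
    rfl

theorem existsUnique_invariant_kernel (hβ : (β : ℝ) < 1) (hε : ε ∈ Set.Ioc 0 1) :
    ∃! μ : ProbabilityMeasure (State S₁ S₂),
      (kernel u₁ u₂ k β ε).Invariant (μ : Measure (State S₁ S₂)) := by
  have hε' := Set.Ioc_subset_Icc_self hε
  have ε_pos : 0 < ε := hε.1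
  exact (isIFSKernel_kernel u₁ u₂ k β hε').existsUnique_invariant
    (isLipschitzIFS_jointProb u₁ u₂ k β hε') (by exact_mod_cast hβ) (by positivity)
    (div_card_mul_div_card_le_jointProb u₁ u₂ k hε')

end JointPlay

section Potential

variable {S₁ S₂ : Type*} [Fintype S₁] [Fintype S₂]

/-- The total weight that the two components of `p` put outside the block `C`. -/
def outsideMass (C : Finset S₁ × Finset S₂) (p : State S₁ S₂) : ℝ :=
  (1 - ∑ s ∈ C.1, p.1.1 s) + (1 - ∑ s ∈ C.2, p.2.1 s)

theorem outsideMass_nonneg (C : Finset S₁ × Finset S₂) (p : State S₁ S₂) :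
    0 ≤ outsideMass C p :=
  add_nonneg (one_sub_sum_nonneg p.1 C.1) (one_sub_sum_nonneg p.2 C.2)

theorem outsideMass_le_two (C : Finset S₁ × Finset S₂) (p : State S₁ S₂) :
    outsideMass C p ≤ 2 := by
  have sum_nonneg₁ : 0 ≤ ∑ s ∈ C.1, p.1.1 s := Finset.sum_nonneg fun s _ => p.1.2.1 s
  have sum_nonneg₂ : 0 ≤ ∑ s ∈ C.2, p.2.1 s := Finset.sum_nonneg fun s _ => p.2.2.1 s
  unfold outsideMass
  linarith

theorem continuous_outsideMass (C : Finset S₁ × Finset S₂) :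
    Continuous (outsideMass C : State S₁ S₂ → ℝ) := by
  unfold outsideMass
  fun_prop

theorem mem_blockNhd_of_outsideMass_le {C : Finset S₁ × Finset S₂} {p : State S₁ S₂} {δ : ℝ}
    (hp : outsideMass C p ≤ δ) : p ∈ blockNhd δ C := by
  have outside_nonneg₁ := one_sub_sum_nonneg p.1 C.1
  have outside_nonneg₂ := one_sub_sum_nonneg p.2 C.2
  unfold outsideMass at hp
  constructor <;> linarith

theorem outsideMass_jointUpdate [DecidableEq S₁] [DecidableEq S₂] (β : unitInterval)
    {C : Finset S₁ × Finset S₂} {s : S₁ × S₂} (hs₁ : s.1 ∈ C.1) (hs₂ : s.2 ∈ C.2)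
    (p : State S₁ S₂) : outsideMass C (jointUpdate β s p) = β * outsideMass C p := by
  simp only [outsideMass, jointUpdate, one_sub_sum_update β _ hs₁, one_sub_sum_update β _ hs₂]
  ring

variable {u₁ : S₁ → S₂ → ℝ} {u₂ : S₂ → S₁ → ℝ} {k : ℕ}

theorem exists_isMinCurb_le {E : Finset S₁ × Finset S₂} (hE : IsCurb u₁ u₂ k E) :
    ∃ C ≤ E, IsMinCurb u₁ u₂ k C :=
  (Set.toFinite {C | IsCurb u₁ u₂ k C}).exists_le_minimal hE

variable (u₁ u₂ k)

/-- The capped and scaled weight outside the nearest minimal CURB block; it plays the role of a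
Lyapunov function. -/
noncomputable def potential (M : ℝ) (p : State S₁ S₂) : ℝ :=
  ⨅ C : {C : Finset S₁ × Finset S₂ // IsMinCurb u₁ u₂ k C}, min 1 (M * outsideMass C.1 p)

variable {u₁ u₂ k} in
theorem potential_le {C : Finset S₁ × Finset S₂} (hC : IsMinCurb u₁ u₂ k C) (M : ℝ)
    (p : State S₁ S₂) : potential u₁ u₂ k M p ≤ min 1 (M * outsideMass C p) :=
  ciInf_le (Set.finite_range _).bddBelow
    (⟨C, hC⟩ : {C : Finset S₁ × Finset S₂ // IsMinCurb u₁ u₂ k C})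

variable [Nonempty S₁] [Nonempty S₂]

theorem nonempty_isMinCurb : Nonempty {C : Finset S₁ × Finset S₂ // IsMinCurb u₁ u₂ k C} := by
  have isCurb_univ : IsCurb u₁ u₂ k (Finset.univ, Finset.univ) :=
    ⟨Finset.univ_nonempty, Finset.univ_nonempty, fun _ _ => Finset.subset_univ _,
      fun _ _ => Finset.subset_univ _⟩
  obtain ⟨C, -, hC⟩ := exists_isMinCurb_le isCurb_univ
  exact ⟨⟨C, hC⟩⟩

theorem exists_potential_eq (M : ℝ) (p : State S₁ S₂) :
    ∃ C, IsMinCurb u₁ u₂ k C ∧ potential u₁ u₂ k M p = min 1 (M * outsideMass C p) := by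
  have := nonempty_isMinCurb u₁ u₂ k
  obtain ⟨C, hC⟩ := exists_eq_ciInf_of_finite
    (f := fun C : {C : Finset S₁ × Finset S₂ // IsMinCurb u₁ u₂ k C} =>
      min 1 (M * outsideMass C.1 p))
  exact ⟨C.1, C.2, hC.symm⟩

theorem potential_le_one (M : ℝ) (p : State S₁ S₂) : potential u₁ u₂ k M p ≤ 1 := by
  obtain ⟨C, -, hC⟩ := exists_potential_eq u₁ u₂ k M p
  exact hC.trans_le (min_le_left _ _)

theorem potential_nonneg {M : ℝ} (hM : 0 ≤ M) (p : State S₁ S₂) :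
    0 ≤ potential u₁ u₂ k M p := by
  have := nonempty_isMinCurb u₁ u₂ k
  exact le_ciInf fun C => le_min zero_le_one (mul_nonneg hM (outsideMass_nonneg C.1 p))

theorem continuous_potential (M : ℝ) : Continuous (potential u₁ u₂ k M) := by
  classical
  have := nonempty_isMinCurb u₁ u₂ k
  have potential_eq_inf' : potential u₁ u₂ k M = fun p => Finset.univ.inf' Finset.univ_nonempty
      fun C : {C : Finset S₁ × Finset S₂ // IsMinCurb u₁ u₂ k C} =>
        min 1 (M * outsideMass C.1 p) := by
    funext p
    rw [Finset.inf'_univ_eq_ciInf]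
    rfl
  rw [potential_eq_inf']
  exact Continuous.finset_inf'_apply _ fun C _ =>
    continuous_const.min (continuous_const.mul (continuous_outsideMass C.1))

variable {u₁ u₂ k}

theorem exists_potential_eq_mul_outsideMass {M : ℝ} {p : State S₁ S₂}
    (hp : potential u₁ u₂ k M p < 1) :
    ∃ C, IsMinCurb u₁ u₂ k C ∧ potential u₁ u₂ k M p = M * outsideMass C p := by
  obtain ⟨C, hC, potential_eq⟩ := exists_potential_eq u₁ u₂ k M p
  have mul_lt_one : M * outsideMass C p < 1 := by simpa [potential_eq] using hp
  exact ⟨C, hC, by rw [potential_eq, min_eq_right mul_lt_one.le]⟩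

theorem mem_minCurbNhd_of_potential_lt {M δ : ℝ} (hM : 0 < M) {p : State S₁ S₂}
    (hp : potential u₁ u₂ k M p < min 1 (M * δ)) : p ∈ minCurbNhd u₁ u₂ k δ := by
  obtain ⟨lt_one, lt_mul⟩ := lt_min_iff.1 hp
  obtain ⟨C, hC, potential_eq⟩ := exists_potential_eq_mul_outsideMass lt_one
  rw [potential_eq] at lt_mul
  exact Set.mem_biUnion (show C ∈ {C | IsMinCurb u₁ u₂ k C} from hC)
    (mem_blockNhd_of_outsideMass_le (lt_of_mul_lt_mul_left lt_mul hM.le).le)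

end Potential

section Drift

variable {S₁ S₂ : Type*} [Fintype S₁] [DecidableEq S₁] [Nonempty S₁] [Fintype S₂]
  [DecidableEq S₂] [Nonempty S₂] {u₁ : S₁ → S₂ → ℝ} {u₂ : S₂ → S₁ → ℝ} {k : ℕ}
  (β : unitInterval)

theorem one_sub_mul_outsideMass_le_sum_jointProb {C : Finset S₁ × Finset S₂}
    (hC : IsCurb u₁ u₂ k C) (p : State S₁ S₂) :
    1 - k * outsideMass C p ≤ ∑ s ∈ C.1 ×ˢ C.2, jointProb u₁ u₂ k 0 s p := by
  obtain ⟨-, -, replies₁, replies₂⟩ := hC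
  have stay₁ := one_sub_mul_le_sum_bestReplyProb u₁ p.2 replies₁
  have stay₂ := one_sub_mul_le_sum_bestReplyProb u₂ p.1 replies₂
  have leave_mul_leave_nonneg :=
    mul_nonneg (sub_nonneg.2 (sum_bestReplyProb_le_one (k := k) u₁ p.2 C.1))
      (sub_nonneg.2 (sum_bestReplyProb_le_one (k := k) u₂ p.1 C.2))
  rw [Finset.sum_product]
  simp only [jointProb, playProb_zero, ← Finset.mul_sum, ← Finset.sum_mul]
  unfold outsideMass
  linarith

theorem markovOp_min_outsideMass_le {C : Finset S₁ × Finset S₂} (hC : IsCurb u₁ u₂ k C) {M : ℝ}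
    (hM : 0 ≤ M) (p : State S₁ S₂) :
    markovOp (jointProb u₁ u₂ k 0) (jointUpdate β) (fun p => min 1 (M * outsideMass C p)) p ≤
      (β * M + k) * outsideMass C p := by
  have out_nonneg := outsideMass_nonneg C p
  have inside_value (s : S₁ × S₂) (hs : s ∈ C.1 ×ˢ C.2) :
      min 1 (M * outsideMass C (jointUpdate β s p)) ≤ min 1 (β * M * outsideMass C p) := by
    obtain ⟨hs₁, hs₂⟩ := Finset.mem_product.1 hs
    rw [outsideMass_jointUpdate β hs₁ hs₂, mul_left_comm, ← mul_assoc]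
  have value_nonneg : 0 ≤ min 1 (β * M * outsideMass C p) :=
    le_min zero_le_one (mul_nonneg (mul_nonneg β.2.1 hM) out_nonneg)
  have escape_nonneg : 0 ≤ k * outsideMass C p := mul_nonneg (Nat.cast_nonneg _) out_nonneg
  calc markovOp (jointProb u₁ u₂ k 0) (jointUpdate β) (fun p => min 1 (M * outsideMass C p)) p
      ≤ 1 - (1 - min 1 (β * M * outsideMass C p)) *
          ∑ s ∈ C.1 ×ˢ C.2, jointProb u₁ u₂ k 0 s p :=
        (isWeight_jointProb_zero u₁ u₂ k).markovOp_le_one_sub_mul_sum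
          (fun _ => min_le_left _ _) inside_value
    _ ≤ 1 - (1 - min 1 (β * M * outsideMass C p)) * (1 - k * outsideMass C p) := by
        gcongr
        · exact sub_nonneg.2 (min_le_left _ _)
        · exact one_sub_mul_outsideMass_le_sum_jointProb hC p
    _ ≤ min 1 (β * M * outsideMass C p) + k * outsideMass C p := by
        nlinarith [mul_nonneg value_nonneg escape_nonneg]
    _ ≤ (β * M + k) * outsideMass C p := by
        rw [add_mul]
        gcongr
        exact min_le_right _ _

variable {M γ : ℝ}

theorem markovOp_potential_le_of_isMinCurb (hM : 0 ≤ M) (hγ : β * M + k ≤ γ * M)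
    {C : Finset S₁ × Finset S₂} (hC : IsMinCurb u₁ u₂ k C) (p : State S₁ S₂) :
    markovOp (jointProb u₁ u₂ k 0) (jointUpdate β) (potential u₁ u₂ k M) p ≤
      γ * (M * outsideMass C p) :=
  calc markovOp (jointProb u₁ u₂ k 0) (jointUpdate β) (potential u₁ u₂ k M) p
      ≤ markovOp (jointProb u₁ u₂ k 0) (jointUpdate β) (fun p => min 1 (M * outsideMass C p)) p :=
        (isWeight_jointProb_zero u₁ u₂ k).monotone_markovOp (fun p => potential_le hC M p) p
    _ ≤ (β * M + k) * outsideMass C p := markovOp_min_outsideMass_le β hC.prop hM p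
    _ ≤ γ * M * outsideMass C p := by
        gcongr
        exact outsideMass_nonneg C p
    _ = γ * (M * outsideMass C p) := mul_assoc _ _ _

theorem markovOp_potential_le (hM : 0 ≤ M) (hγ : β * M + k ≤ γ * M) (hγ₁ : γ ≤ 1) :
    markovOp (jointProb u₁ u₂ k 0) (jointUpdate β) (potential u₁ u₂ k M) ≤
      potential u₁ u₂ k M := by
  intro p
  obtain ⟨C, hC, potential_eq⟩ := exists_potential_eq u₁ u₂ k M p
  rw [potential_eq]
  exact le_min
    ((isWeight_jointProb_zero u₁ u₂ k).iterate_markovOp_le (potential_le_one u₁ u₂ k M) 1 p)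
    ((markovOp_potential_le_of_isMinCurb β hM hγ hC p).trans
      (mul_le_of_le_one_left (mul_nonneg hM (outsideMass_nonneg C p)) hγ₁))

theorem markovOp_potential_le_mul (hM : 0 ≤ M) (hγ : β * M + k ≤ γ * M) {p : State S₁ S₂}
    (hp : potential u₁ u₂ k M p < 1) :
    markovOp (jointProb u₁ u₂ k 0) (jointUpdate β) (potential u₁ u₂ k M) p ≤
      γ * potential u₁ u₂ k M p := by
  obtain ⟨C, hC, potential_eq⟩ := exists_potential_eq_mul_outsideMass hp
  rw [potential_eq]
  exact markovOp_potential_le_of_isMinCurb β hM hγ hC p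

end Drift

section Reachability

variable {S₁ S₂ : Type*} [Fintype S₁] [Fintype S₂]

/-- The states in which every action of the block `E` has weight at least `c`. -/
def heavySet (E : Finset S₁ × Finset S₂) (c : ℝ) : Set (State S₁ S₂) :=
  {p | (∀ a ∈ E.1, c ≤ p.1.1 a) ∧ ∀ a ∈ E.2, c ≤ p.2.1 a}

/-- Both actions of the profile `s` are best replies to mixed strategies that can arise as samples
of size `k` from the block `E`. -/
def IsSampleReply (u₁ : S₁ → S₂ → ℝ) (u₂ : S₂ → S₁ → ℝ) (k : ℕ) (E : Finset S₁ × Finset S₂)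
    (s : S₁ × S₂) : Prop :=
  (∃ σ ∈ lattice k E.2, s.1 ∈ bestReplies u₁ σ) ∧ ∃ σ ∈ lattice k E.1, s.2 ∈ bestReplies u₂ σ

theorem heavySet_anti {C E : Finset S₁ × Finset S₂} (hCE : C ≤ E) (c : ℝ) :
    heavySet E c ⊆ heavySet C c :=
  fun _ hp => ⟨fun a ha => hp.1 a (hCE.1 ha), fun a ha => hp.2 a (hCE.2 ha)⟩

theorem iUnion_heavySet_singleton [Nonempty S₁] [Nonempty S₂] :
    ⋃ a : S₁ × S₂, heavySet ({a.1}, {a.2})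
      (min (1 / (Fintype.card S₁ : ℝ)) (1 / Fintype.card S₂)) = Set.univ := by
  refine Set.eq_univ_of_forall fun p => ?_
  obtain ⟨a₁, ha₁⟩ := exists_one_div_card_le p.1
  obtain ⟨a₂, ha₂⟩ := exists_one_div_card_le p.2
  refine Set.mem_iUnion.2 ⟨(a₁, a₂), ?_, ?_⟩
  · simpa only [Finset.mem_singleton, forall_eq] using (min_le_left _ _).trans ha₁
  · simpa only [Finset.mem_singleton, forall_eq] using (min_le_right _ _).trans ha₂

variable {u₁ : S₁ → S₂ → ℝ} {u₂ : S₂ → S₁ → ℝ} {k : ℕ} {E C : Finset S₁ × Finset S₂}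
  {s : S₁ × S₂} {c : ℝ}

theorem IsSampleReply.mem_of_isCurb (hs : IsSampleReply u₁ u₂ k C s) (hC : IsCurb u₁ u₂ k C) :
    s.1 ∈ C.1 ∧ s.2 ∈ C.2 := by
  obtain ⟨⟨σ₂, hσ₂, hs₁⟩, σ₁, hσ₁, hs₂⟩ := hs
  exact ⟨hC.2.2.1 σ₂ hσ₂ hs₁, hC.2.2.2 σ₁ hσ₁ hs₂⟩

theorem exists_isSampleReply [Nonempty S₁] [Nonempty S₂] (hE₁ : E.1.Nonempty)
    (hE₂ : E.2.Nonempty) :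
    ∃ s, IsSampleReply u₁ u₂ k E s := by
  obtain ⟨σ₁, hσ₁⟩ := lattice_nonempty (k := k) hE₁
  obtain ⟨σ₂, hσ₂⟩ := lattice_nonempty (k := k) hE₂
  obtain ⟨s₁, hs₁⟩ := bestReplies_nonempty u₁ σ₂
  obtain ⟨s₂, hs₂⟩ := bestReplies_nonempty u₂ σ₁
  exact ⟨(s₁, s₂), ⟨σ₂, hσ₂, hs₁⟩, σ₁, hσ₁, hs₂⟩

variable [DecidableEq S₁] [DecidableEq S₂]

theorem jointUpdate_mem_heavySet (β : unitInterval) {p : State S₁ S₂} (hp : p ∈ heavySet E c)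
    (s : S₁ × S₂) :
    jointUpdate β s p ∈ heavySet (insert s.1 E.1, insert s.2 E.2) (min (β * c) (1 - β)) :=
  ⟨min_le_update_of_mem_insert β p.1 hp.1 s.1, min_le_update_of_mem_insert β p.2 hp.2 s.2⟩

theorem IsSampleReply.le_jointProb (hs : IsSampleReply u₁ u₂ k E s) (hk : 1 ≤ k) (hc : 0 ≤ c)
    {p : State S₁ S₂} (hp : p ∈ heavySet E c) :
    c ^ k / Fintype.card S₁ * (c ^ k / Fintype.card S₂) ≤ jointProb u₁ u₂ k 0 s p := by
  obtain ⟨⟨σ₂, hσ₂, hs₁⟩, σ₁, hσ₁, hs₂⟩ := hs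
  simp only [jointProb, playProb_zero]
  exact mul_le_mul (pow_div_card_le_bestReplyProb_of_mem_lattice u₁ p.2 hk hc hp.2 hσ₂ hs₁)
    (pow_div_card_le_bestReplyProb_of_mem_lattice u₂ p.1 hk hc hp.1 hσ₁ hs₂) (by positivity)
    (bestReplyProb_nonneg _ _ _ _)

variable [Nonempty S₁] [Nonempty S₂]

theorem exists_isSampleReply_lt_insert (hE₁ : E.1.Nonempty) (hE₂ : E.2.Nonempty)
    (hE : ¬ IsCurb u₁ u₂ k E) :
    ∃ s, IsSampleReply u₁ u₂ k E s ∧ E < (insert s.1 E.1, insert s.2 E.2) := by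
  obtain ⟨s, reply₁, reply₂⟩ := exists_isSampleReply (u₁ := u₁) (u₂ := u₂) (k := k) hE₁ hE₂
  have some_reply_outside : (∃ σ ∈ lattice k E.2, ¬ bestReplies u₁ σ ⊆ E.1) ∨
      ∃ σ ∈ lattice k E.1, ¬ bestReplies u₂ σ ⊆ E.2 := by
    by_contra! replies_subset
    exact hE ⟨hE₁, hE₂, replies_subset.1, replies_subset.2⟩
  rcases some_reply_outside with ⟨σ, hσ, not_subset⟩ | ⟨σ, hσ, not_subset⟩
  · obtain ⟨a, ha, a_notMem⟩ := Finset.not_subset.1 not_subset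
    exact ⟨(a, s.2), ⟨⟨σ, hσ, ha⟩, reply₂⟩, Prod.mk_lt_mk_of_lt_of_le
      (Finset.ssubset_insert a_notMem) (Finset.subset_insert _ _)⟩
  · obtain ⟨a, ha, a_notMem⟩ := Finset.not_subset.1 not_subset
    exact ⟨(s.1, a), ⟨reply₁, σ, hσ, ha⟩, Prod.mk_lt_mk_of_le_of_lt
      (Finset.subset_insert _ _) (Finset.ssubset_insert a_notMem)⟩

variable (β : unitInterval) {M : ℝ}

theorem dropsOn_heavySet_inter_of_isMinCurb (hk : 1 ≤ k) (hβ : (β : ℝ) ∈ Set.Ioo 0 1)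
    (hM : 0 ≤ M) (hC : IsMinCurb u₁ u₂ k C) (hc : 0 < c) {r : ℝ} (n : ℕ)
    (hn : M * (β ^ n * r) ≤ 1 / 2) :
    DropsOn (jointProb u₁ u₂ k 0) (jointUpdate β) (potential u₁ u₂ k M)
      (heavySet C c ∩ {p | outsideMass C p ≤ r}) := by
  induction n generalizing c r with
  | zero =>
    refine DropsOn.of_le one_half_pos fun p hp => ?_
    calc potential u₁ u₂ k M p ≤ M * outsideMass C p :=
          (potential_le hC M p).trans (min_le_right _ _)
      _ ≤ M * r := mul_le_mul_of_nonneg_left hp.2 hM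
      _ ≤ 1 - 1 / 2 := by linarith
  | succ n ih =>
    obtain ⟨s, hs⟩ := exists_isSampleReply (u₁ := u₁) (u₂ := u₂) (k := k) hC.prop.1 hC.prop.2.1
    obtain ⟨hs₁, hs₂⟩ := hs.mem_of_isCurb hC.prop
    have c'_pos : 0 < min (β * c) (1 - β) := lt_min (mul_pos hβ.1 hc) (sub_pos.2 hβ.2)
    refine (isWeight_jointProb_zero u₁ u₂ k).dropsOn_of_step (potential_le_one u₁ u₂ k M)
      (ih c'_pos (r := β * r) (by rwa [← mul_assoc (_ ^ n), ← pow_succ]))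
      (c := c ^ k / Fintype.card S₁ * (c ^ k / Fintype.card S₂)) (by positivity)
      fun p hp => ⟨s, hs.le_jointProb hk hc.le hp.1, ?_, ?_⟩
    · simpa only [Finset.insert_eq_of_mem hs₁, Finset.insert_eq_of_mem hs₂] using
        jointUpdate_mem_heavySet β hp.1 s
    · rw [Set.mem_ofPred_eq, outsideMass_jointUpdate β hs₁ hs₂]
      exact mul_le_mul_of_nonneg_left hp.2 β.2.1

theorem dropsOn_heavySet_of_isMinCurb (hk : 1 ≤ k) (hβ : (β : ℝ) ∈ Set.Ioo 0 1) (hM : 0 ≤ M)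
    (hC : IsMinCurb u₁ u₂ k C) (hc : 0 < c) :
    DropsOn (jointProb u₁ u₂ k 0) (jointUpdate β) (potential u₁ u₂ k M) (heavySet C c) := by
  have tendsto_zero : Tendsto (fun n : ℕ => M * ((β : ℝ) ^ n * 2)) atTop (𝓝 0) := by
    simpa using ((tendsto_pow_atTop_nhds_zero_of_lt_one hβ.1.le hβ.2).mul_const 2).const_mul M
  obtain ⟨n, hn⟩ := (tendsto_zero.eventually_le_const one_half_pos).exists
  exact (dropsOn_heavySet_inter_of_isMinCurb β hk hβ hM hC hc n hn).mono
    fun p hp => ⟨hp, outsideMass_le_two C p⟩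

-- Best replies to samples from `E` enlarge `E` until it is a CURB block.
theorem dropsOn_heavySet (hk : 1 ≤ k) (hβ : (β : ℝ) ∈ Set.Ioo 0 1) (hM : 0 ≤ M)
    (E : Finset S₁ × Finset S₂) (hE₁ : E.1.Nonempty) (hE₂ : E.2.Nonempty) (hc : 0 < c) :
    DropsOn (jointProb u₁ u₂ k 0) (jointUpdate β) (potential u₁ u₂ k M) (heavySet E c) := by
  induction E using WellFoundedGT.induction generalizing c with
  | ind E ih =>
    by_cases hE : IsCurb u₁ u₂ k E
    · obtain ⟨C, hCE, hC⟩ := exists_isMinCurb_le hE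
      exact (dropsOn_heavySet_of_isMinCurb β hk hβ hM hC hc).mono (heavySet_anti hCE c)
    · obtain ⟨s, hs, lt_insert⟩ := exists_isSampleReply_lt_insert hE₁ hE₂ hE
      have c'_pos : 0 < min (β * c) (1 - β) := lt_min (mul_pos hβ.1 hc) (sub_pos.2 hβ.2)
      exact (isWeight_jointProb_zero u₁ u₂ k).dropsOn_of_step (potential_le_one u₁ u₂ k M)
        (ih _ lt_insert (Finset.insert_nonempty _ _) (Finset.insert_nonempty _ _) c'_pos)
        (c := c ^ k / Fintype.card S₁ * (c ^ k / Fintype.card S₂)) (by positivity)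
        fun p hp => ⟨s, hs.le_jointProb hk hc.le hp, jointUpdate_mem_heavySet β hp s⟩

variable {γ : ℝ}

theorem dropsOn_univ (hk : 1 ≤ k) (hβ : (β : ℝ) ∈ Set.Ioo 0 1) (hM : 0 ≤ M)
    (hγ : β * M + k ≤ γ * M) (hγ₁ : γ ≤ 1) :
    DropsOn (jointProb u₁ u₂ k 0) (jointUpdate β) (potential u₁ u₂ k M) Set.univ := by
  rw [← iUnion_heavySet_singleton]
  exact (isWeight_jointProb_zero u₁ u₂ k).dropsOn_iUnion
    (markovOp_potential_le β hM hγ hγ₁) fun a => dropsOn_heavySet β hk hβ hM _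
      (Finset.singleton_nonempty _) (Finset.singleton_nonempty _) (by positivity)

theorem exists_iterate_markovOp_potential_le_mul (hk : 1 ≤ k) (hβ : (β : ℝ) ∈ Set.Ioo 0 1)
    (hM : 0 ≤ M) (hγ : β * M + k ≤ γ * M) (hγ₁ : γ < 1) :
    ∃ N : ℕ, ∃ θ < 1, ∀ p,
      (markovOp (jointProb u₁ u₂ k 0) (jointUpdate β))^[N] (potential u₁ u₂ k M) p ≤
        θ * potential u₁ u₂ k M p := by
  obtain ⟨N, η, η_pos, drop⟩ := dropsOn_univ (u₁ := u₁) (u₂ := u₂) β hk hβ hM hγ hγ₁.le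
  have anti := ((isWeight_jointProb_zero u₁ u₂ k).monotone_markovOp
    (T := jointUpdate β)).antitone_iterate_of_map_le (markovOp_potential_le β hM hγ hγ₁.le)
  refine ⟨N + 1, max γ (1 - η), max_lt hγ₁ (by linarith), fun p => ?_⟩
  rcases (potential_le_one u₁ u₂ k M p).lt_or_eq with hp | hp
  · exact (anti (Nat.le_add_left 1 N) p).trans ((markovOp_potential_le_mul β hM hγ hp).trans
      (mul_le_mul_of_nonneg_right (le_max_left _ _) (potential_nonneg u₁ u₂ k hM p)))
  · rw [hp, mul_one]
    exact (anti (Nat.le_succ N) p).trans ((drop p (Set.mem_univ p)).trans (le_max_right _ _))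

end Reachability

section SmallErrors

variable {S₁ S₂ : Type*} [Fintype S₁] [Nonempty S₁] [Fintype S₂] [Nonempty S₂]
  {u₁ : S₁ → S₂ → ℝ} {u₂ : S₂ → S₁ → ℝ} {k : ℕ}

theorem one_sub_ofReal_integral_div_le_measure_minCurbNhd {M δ : ℝ} (hM : 0 < M) (hδ : 0 < δ)
    (μ : ProbabilityMeasure (State S₁ S₂)) :
    1 - ENNReal.ofReal ((∫ p, potential u₁ u₂ k M p ∂μ) / min 1 (M * δ)) ≤
      (μ : Measure (State S₁ S₂)) (minCurbNhd u₁ u₂ k δ) := by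
  have threshold_pos : 0 < min 1 (M * δ) := lt_min one_pos (mul_pos hM hδ)
  have measure_large_le : (μ : Measure (State S₁ S₂))
      {p | min 1 (M * δ) ≤ potential u₁ u₂ k M p} ≤
        ENNReal.ofReal ((∫ p, potential u₁ u₂ k M p ∂μ) / min 1 (M * δ)) := by
    rw [← ofReal_measureReal]
    refine ENNReal.ofReal_le_ofReal ((le_div_iff₀' threshold_pos).2 ?_)
    exact mul_meas_ge_le_integral_of_nonneg (.of_forall (potential_nonneg u₁ u₂ k hM.le))
      (integrable_of_continuous (continuous_potential u₁ u₂ k M)) _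
  rw [tsub_le_iff_right, ← measure_univ (μ := (μ : Measure (State S₁ S₂)))]
  calc (μ : Measure (State S₁ S₂)) Set.univ
      ≤ (μ : Measure (State S₁ S₂))
          (minCurbNhd u₁ u₂ k δ ∪ {p | min 1 (M * δ) ≤ potential u₁ u₂ k M p}) :=
        measure_mono fun p _ => (lt_or_ge _ _).imp (mem_minCurbNhd_of_potential_lt hM) id
    _ ≤ _ := (measure_union_le _ _).trans (add_le_add_right measure_large_le _)

variable [DecidableEq S₁] [DecidableEq S₂] (β : unitInterval)

theorem exists_integral_potential_le (hk : 1 ≤ k) (hβ : (β : ℝ) ∈ Set.Ioo 0 1) :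
    ∃ M > 0, ∃ R : ℝ, ∀ ε ∈ Set.Icc (0 : ℝ) 1, ∀ μ : ProbabilityMeasure (State S₁ S₂),
      (kernel u₁ u₂ k β ε).Invariant (μ : Measure (State S₁ S₂)) →
      ∫ p, potential u₁ u₂ k M p ∂μ ≤ R * ε := by
  have one_sub_pos : 0 < 1 - (β : ℝ) := sub_pos.2 hβ.2
  have hM : 0 < 2 * k / (1 - (β : ℝ)) :=
    div_pos (mul_pos two_pos (Nat.cast_pos.2 hk)) one_sub_pos
  have hMβ : 2 * k / (1 - (β : ℝ)) * (1 - β) = 2 * k := div_mul_cancel₀ _ one_sub_pos.ne'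
  obtain ⟨N, θ, hθ, decay⟩ := exists_iterate_markovOp_potential_le_mul (u₁ := u₁) (u₂ := u₂) β hk
    hβ (γ := (1 + β) / 2) hM.le (by linarith) (by linarith)
  refine ⟨_, hM, N * (Fintype.card (S₁ × S₂) * 2) / (1 - θ), fun ε hε μ hμ => ?_⟩
  have hV (p : State S₁ S₂) : |potential u₁ u₂ k (2 * k / (1 - (β : ℝ))) p| ≤ 1 :=
    abs_le.2 ⟨by linarith [potential_nonneg u₁ u₂ k hM.le p], potential_le_one u₁ u₂ k _ p⟩
  have integral_le := (isIFSKernel_kernel u₁ u₂ k β hε).one_sub_mul_integral_le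
    (isWeight_jointProb_zero u₁ u₂ k) (sum_abs_jointProb_sub_jointProb_zero_le u₁ u₂ k hε)
    (continuous_potential u₁ u₂ k _) hV decay hμ
  rw [div_mul_eq_mul_div, le_div_iff₀ (sub_pos.2 hθ)]
  linarith

theorem tendsto_measure_minCurbNhd (hk : 1 ≤ k) (hβ : (β : ℝ) ∈ Set.Ioo 0 1)
    {μ : ℝ → ProbabilityMeasure (State S₁ S₂)}
    (hμ : ∀ ε ∈ Set.Ioc (0 : ℝ) 1,
      (kernel u₁ u₂ k β ε).Invariant (μ ε : Measure (State S₁ S₂))) {δ : ℝ} (hδ : 0 < δ) :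
    Tendsto (fun ε : ℝ => (μ ε : Measure (State S₁ S₂)) (minCurbNhd u₁ u₂ k δ)) (𝓝[>] 0)
      (𝓝 1) := by
  obtain ⟨M, hM, R, integral_le⟩ := exists_integral_potential_le (u₁ := u₁) (u₂ := u₂) β hk hβ
  have error_tendsto :
      Tendsto (fun ε : ℝ => ENNReal.ofReal (R * ε / min 1 (M * δ))) (𝓝[>] 0) (𝓝 0) := by
    refine tendsto_nhdsWithin_of_tendsto_nhds ?_
    rw [← ENNReal.ofReal_zero]
    refine ENNReal.tendsto_ofReal (Continuous.tendsto' ?_ _ _ (by simp))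
    fun_prop
  have lower_tendsto :
      Tendsto (fun ε : ℝ => 1 - ENNReal.ofReal (R * ε / min 1 (M * δ))) (𝓝[>] 0) (𝓝 1) := by
    simpa using ENNReal.Tendsto.sub tendsto_const_nhds error_tendsto (.inl ENNReal.one_ne_top)
  refine tendsto_of_tendsto_of_tendsto_of_le_of_le' lower_tendsto tendsto_const_nhds ?_
    (.of_forall fun ε => prob_le_one)
  filter_upwards [Ioc_mem_nhdsGT (zero_lt_one' ℝ)] with ε hε
  refine le_trans ?_ (one_sub_ofReal_integral_div_le_measure_minCurbNhd hM hδ (μ ε))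
  gcongr
  exact integral_le ε (Set.Ioc_subset_Icc_self hε) (μ ε) (hμ ε hε)

end SmallErrors

end RWS

theorem theorem2_general {S₁ S₂ : Type*} [Fintype S₁] [DecidableEq S₁] [Nonempty S₁]
    [Fintype S₂] [DecidableEq S₂] [Nonempty S₂]
    (u₁ : S₁ → S₂ → ℝ) (u₂ : S₂ → S₁ → ℝ) (k : ℕ) (hk : 1 ≤ k) (β : unitInterval)
    (hβ : (β : ℝ) ∈ Set.Ioo 0 1) :
    ∃ μ : ℝ → MeasureTheory.ProbabilityMeasure (RWS.State S₁ S₂),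
      (∀ ε ∈ Set.Ioc (0 : ℝ) 1, ∀ ν : MeasureTheory.ProbabilityMeasure (RWS.State S₁ S₂),
        ProbabilityTheory.Kernel.Invariant (RWS.kernel u₁ u₂ k β ε)
          (ν : MeasureTheory.Measure (RWS.State S₁ S₂)) ↔ ν = μ ε) ∧
      ∀ δ : ℝ, 0 < δ →
        Filter.Tendsto
          (fun ε : ℝ => (μ ε : MeasureTheory.Measure (RWS.State S₁ S₂))
            (RWS.minCurbNhd u₁ u₂ k δ))
          (nhdsWithin 0 (Set.Ioi 0)) (nhds 1) := by
  have existsUnique (ε : ℝ) (hε : ε ∈ Set.Ioc (0 : ℝ) 1) :=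
    RWS.existsUnique_invariant_kernel u₁ u₂ k β hβ.2 hε
  have : Nonempty (ProbabilityMeasure (RWS.State S₁ S₂)) :=
    (existsUnique 1 (Set.right_mem_Ioc.2 one_pos)).exists.nonempty
  choose! μ invariant unique using existsUnique
  exact ⟨μ, fun ε hε ν => ⟨unique ε hε ν, fun hν => hν ▸ invariant ε hε⟩,
    fun δ hδ => RWS.tendsto_measure_minCurbNhd β hk hβ invariant hδ⟩

theorem theorem2 {S₁ S₂ : Type*} [Fintype S₁] [DecidableEq S₁] [Nonempty S₁]
    [Fintype S₂] [DecidableEq S₂] [Nonempty S₂]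
    (u₁ : S₁ → S₂ → ℝ) (u₂ : S₂ → S₁ → ℝ) (k : ℕ) (hk : 1 ≤ k) (β : unitInterval)
    (hβ : (β : ℝ) ∈ Set.Ioo
      (1 - 1 / ((max (Fintype.card S₁) (Fintype.card S₂) : ℕ) : ℝ)) 1) :
    ∃ μ : ℝ → MeasureTheory.ProbabilityMeasure (RWS.State S₁ S₂),
      (∀ ε ∈ Set.Ioc (0 : ℝ) 1, ∀ ν : MeasureTheory.ProbabilityMeasure (RWS.State S₁ S₂),
        ProbabilityTheory.Kernel.Invariant (RWS.kernel u₁ u₂ k β ε)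
          (ν : MeasureTheory.Measure (RWS.State S₁ S₂)) ↔ ν = μ ε) ∧
      ∀ δ : ℝ, 0 < δ →
        Filter.Tendsto
          (fun ε : ℝ => (μ ε : MeasureTheory.Measure (RWS.State S₁ S₂))
            (RWS.minCurbNhd u₁ u₂ k δ))
          (nhdsWithin 0 (Set.Ioi 0)) (nhds 1) :=
  theorem2_general u₁ u₂ k hk β ⟨(Nat.one_sub_one_div_cast_nonneg _).trans_lt hβ.1, hβ.2⟩
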